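/- Let $k$ be a field, let $q\in k[x,y]$ be a nonzero homogeneous polynomial of degree $2$, and let $R=k[x,y]/\langle q\rangle$ with its standard grading. Let $\mathbb V$ be the $\mathbb Q$-vector space of matrices $v=(v_{i,j})_{i\in\mathbb N,\,j\in\mathbb Z}$ with rational entries that are column-finite, i.e. for each $i$ only finitely many $v_{i,j}$ are nonzero. For a finitely generated $\mathbb Z$-graded $R$-module $M$ with minimal graded free resolution $F_0\leftarrow F_1\leftarrow F_2\leftarrow\cdots$, $F_i=\bigoplus_j R(-j)^{\beta^R_{i,j}(M)}$, the Betti diagram of $M$ is $\beta^R(M)=(\beta^R_{i,j}(M))_{i,j}\in\mathbb V$. An $R$-degree sequence is a sequence of one of the forms $(d_0,\infty,\infty,\dots)$, $(d_0,d_1,\infty,\infty,\dots)$ with $d_0<d_1$, or $(d_0,d_1,d_1+1,d_1+2,\dots)$ with $d_0<d_1$, where $d_0,d_1\in\mathbb Z$. Its pure diagram $\pi_d\in\mathbb V$ has $(i,j)$-entry $0$ whenever $j\neq d_i$, while the entries at the positions $(i,d_i)$ with $d_i\ne\infty$ are: $1$ at $i=0$ in the first form; $1$ at $i=0$ and $1$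 at $i=1$ in the second form; $1$ at $i=0$ and $2$ at every $i\ge1$ in the third form. Define functionals on $\mathbb V$ by $$\epsilon_{i,j}(v)=v_{i,j},\qquad \alpha_k=\epsilon_{1,k}-\epsilon_{2,k+1},\qquad \gamma_k=\sum_{j\le k}\bigl(2\epsilon_{0,j}-2\epsilon_{1,j+1}+\epsilon_{2,j+2}\bigr).$$ **Theorem.** The following three cones in $\mathbb V$ are equal: 1. the cone $\mathrm B_{\mathbb Q}(R)$ of all finite linear combinations, with coefficients in $\mathbb Q_{\ge0}$, of Betti diagrams $\beta^R(M)$ of finitely generated graded $R$-modules $M$; 2. the cone $D$ of all finite linear combinations, with coefficients in $\mathbb Q_{\ge0}$, of the pure diagrams $\pi_d$, where $d$ runs over all $R$-degree sequences; 3. the cone $F$ of all $v\in\mathbb V$ such that $\epsilon_{i,j}(v)\ge0$ for $i\in\{0,2\}$ and $j\in\mathbb Z$; $\alpha_k(v)\ge0$ for $k\in\mathbb Z$; $\gamma_k(v)\ge0$ for $k\in\mathbb Z$; and $\pm\bigl(\epsilon_{i,j}-\epsilon_{i+1,j+1}\bigr)(v)\ge0$ for $i\ge2$ and $j\in\mathbb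 Z$. -/

import Mathlib

universe u v

noncomputable section

namespace QuadricBetti

open MvPolynomial

/-! ### Minimal graded free resolutions -/

section Resolution

variable {A : Type u} [CommRing A] (𝒜 : ℤ → AddSubgroup A)

/-- The ideal generated by all homogeneous elements of positive degree. -/
def irrelevant : Ideal A := Ideal.span {a : A | ∃ n : ℤ, 0 < n ∧ a ∈ 𝒜 n}

/-- A minimal graded free resolution `F 0 ← F 1 ← F 2 ← ⋯` of a module `M` with grading `ℳ`, over a
ring `A` with grading `𝒜`. Here `F i` is the graded free module `⨁ₐ A(-(deg i a))`, `a` running over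
`Fin (rank i)`; it is written as `Fin (rank i) → A`, and its basis vector `Pi.single a 1` has degree
`deg i a`. A linear map is graded (of degree zero) iff it sends each basis vector to an element of
the degree of that vector. -/
structure MinimalGradedFreeResolution {M : Type v} [AddCommGroup M] [Module A M]
    (ℳ : ℤ → AddSubgroup M) where
  rank : ℕ → ℕ
  deg : ∀ i : ℕ, Fin (rank i) → ℤ
  aug : (Fin (rank 0) → A) →ₗ[A] M
  d : ∀ i : ℕ, (Fin (rank (i + 1)) → A) →ₗ[A] (Fin (rank i) → A)
  aug_mem : ∀ a : Fin (rank 0), aug (Pi.single a 1) ∈ ℳ (deg 0 a)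
  d_mem : ∀ (i : ℕ) (a : Fin (rank (i + 1))) (b : Fin (rank i)),
    d i (Pi.single a 1) b ∈ 𝒜 (deg (i + 1) a - deg i b)
  aug_surjective : Function.Surjective aug
  exact_zero : Function.Exact (d 0) aug
  exact_succ : ∀ i : ℕ, Function.Exact (d (i + 1)) (d i)
  minimal : ∀ i : ℕ,
    LinearMap.range (d i) ≤ irrelevant 𝒜 • (⊤ : Submodule A (Fin (rank i) → A))

end Resolution

/-! ### Diagrams -/

/-- The space of column-finite rational matrices, the columns being indexed by `i : ℕ` and the rows
by `j : ℤ`; the `(i, j)` entry of `v` is `v i j`. -/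
abbrev Diagram : Type := ℕ → (ℤ →₀ ℚ)

section Betti

variable {A : Type u} [CommRing A] {𝒜 : ℤ → AddSubgroup A}
  {M : Type v} [AddCommGroup M] [Module A M] {ℳ : ℤ → AddSubgroup M}

/-- The diagram whose `(i, j)` entry is the number `β i j` of summands `A(-j)` of `F i`. -/
def MinimalGradedFreeResolution.diagram (F : MinimalGradedFreeResolution 𝒜 ℳ) : Diagram :=
  fun i => ∑ a : Fin (F.rank i), Finsupp.single (F.deg i a) (1 : ℚ)

theorem MinimalGradedFreeResolution.diagram_apply (F : MinimalGradedFreeResolution 𝒜 ℳ)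
    (i : ℕ) (j : ℤ) :
    F.diagram i j = ((Finset.univ.filter fun a : Fin (F.rank i) => F.deg i a = j).card : ℚ) := by
  classical
  simp [MinimalGradedFreeResolution.diagram, Finsupp.finsetSum_apply, Finsupp.single_apply]

end Betti

/-- `v` is the Betti diagram of some finitely generated graded module over the graded ring `A`.
(All modules here live in the universe of `A`, which contains every finitely generated `A`-module
up to isomorphism.) -/
def IsBettiDiagram {A : Type u} [CommRing A] (𝒜 : ℤ → AddSubgroup A) (v : Diagram) : Prop :=
  ∃ (M : Type u) (_ : AddCommGroup M) (_ : Module A M) (ℳ : ℤ → AddSubgroup M),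
    Module.Finite A M ∧ DirectSum.IsInternal ℳ ∧ SetLike.GradedSMul 𝒜 ℳ ∧
      ∃ F : MinimalGradedFreeResolution 𝒜 ℳ, F.diagram = v

/-- The cone of Betti diagrams: the set of all combinations, with nonnegative rational coefficients,
of finitely many Betti diagrams of finitely generated graded modules. -/
def bettiCone {A : Type u} [CommRing A] (𝒜 : ℤ → AddSubgroup A) : PointedCone ℚ Diagram :=
  PointedCone.hull ℚ {v : Diagram | IsBettiDiagram 𝒜 v}

/-! ### The ring `k[x, y] / (q)` with its standard grading -/

/-- The ring `k[x, y] / (q)`. -/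
abbrev QuadricRing {k : Type u} [Field k] (q : MvPolynomial (Fin 2) k) : Type u :=
  MvPolynomial (Fin 2) k ⧸ Ideal.span {q}

/-- The piece of degree `j` consists of the classes of the forms of degree `j`, where both variables
have degree `1 : ℤ`; it vanishes for `j < 0`. -/
def quadricGrading {k : Type u} [Field k] (q : MvPolynomial (Fin 2) k) (j : ℤ) :
    AddSubgroup (QuadricRing q) :=
  ((weightedHomogeneousSubmodule k (fun _ : Fin 2 => (1 : ℤ)) j).map
    (Ideal.Quotient.mkₐ k (Ideal.span {q})).toLinearMap).toAddSubgroup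

/-! ### Degree sequences and pure diagrams -/

/-- The three kinds of degree sequences: `(d₀, ∞, ∞, …)`, `(d₀, d₁, ∞, ∞, …)` with `d₀ < d₁`, and
`(d₀, d₁, d₁ + 1, d₁ + 2, …)` with `d₀ < d₁`. -/
inductive DegreeSequence : Type
  | free (d₀ : ℤ)
  | finite (d₀ d₁ : ℤ) (h : d₀ < d₁)
  | infinite (d₀ d₁ : ℤ) (h : d₀ < d₁)

/-- The entries of a degree sequence, in `ℤ ∪ {∞}`. -/
def DegreeSequence.entry : DegreeSequence → ℕ → WithTop ℤ
  | .free d₀, 0 => d₀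
  | .free _, _ + 1 => ⊤
  | .finite d₀ _ _, 0 => d₀
  | .finite _ d₁ _, 1 => d₁
  | .finite _ _ _, _ + 2 => ⊤
  | .infinite d₀ _ _, 0 => d₀
  | .infinite _ d₁ _, i + 1 => ((d₁ + i : ℤ) : WithTop ℤ)

/-- The pure diagram `π_d`: its column `i` vanishes outside row `d i`, where the entries are
`1, 0, 0, …` for `(d₀, ∞, …)`, `1, 1, 0, 0, …` for `(d₀, d₁, ∞, …)`, and `1, 2, 2, 2, …` for
`(d₀, d₁, d₁ + 1, …)`. -/
def pureDiagram : DegreeSequence → Diagram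
  | .free d₀, 0 => Finsupp.single d₀ 1
  | .free _, _ + 1 => 0
  | .finite d₀ _ _, 0 => Finsupp.single d₀ 1
  | .finite _ d₁ _, 1 => Finsupp.single d₁ 1
  | .finite _ _ _, _ + 2 => 0
  | .infinite d₀ _ _, 0 => Finsupp.single d₀ 1
  | .infinite _ d₁ _, i + 1 => Finsupp.single (d₁ + i) 2

/-- The pure diagram `π_d` is supported at the positions `(i, d i)`. -/
theorem pureDiagram_ne_zero_iff (d : DegreeSequence) (i : ℕ) (j : ℤ) :
    pureDiagram d i j ≠ 0 ↔ d.entry i = (j : WithTop ℤ) := by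
  rcases d with d₀ | ⟨d₀, d₁, h⟩ | ⟨d₀, d₁, h⟩ <;> rcases i with _ | _ | i <;>
    (simp [pureDiagram, DegreeSequence.entry, Finsupp.single_apply]; try norm_cast)

/-- The cone spanned by all pure diagrams. -/
def pureCone : PointedCone ℚ Diagram := PointedCone.hull ℚ (Set.range pureDiagram)

/-! ### Functionals and the cone cut out by halfspaces -/

/-- `ε_{i,j}(v) = v_{i,j}`. -/
def epsilon (i : ℕ) (j : ℤ) : Diagram →ₗ[ℚ] ℚ := Finsupp.lapply j ∘ₗ LinearMap.proj i

/-- `α_k = ε_{1,k} - ε_{2,k+1}`. -/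
def alpha (k : ℤ) : Diagram →ₗ[ℚ] ℚ := epsilon 1 k - epsilon 2 (k + 1)

/-- The `j`-th summand `2 ε_{0,j} - 2 ε_{1,j+1} + ε_{2,j+2}` of the functionals `γ_k`. -/
def gammaTerm (j : ℤ) : Diagram →ₗ[ℚ] ℚ :=
  (2 : ℚ) • epsilon 0 j - (2 : ℚ) • epsilon 1 (j + 1) + epsilon 2 (j + 2)

theorem gammaTerm_support_finite (v : Diagram) :
    (Function.support fun j : ℤ => gammaTerm j v).Finite := by
  have h1 : (Function.support fun j : ℤ => v 1 (j + 1)).Finite :=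
    (v 1).hasFiniteSupport.preimage ((add_left_injective (1 : ℤ)).injOn)
  have h2 : (Function.support fun j : ℤ => v 2 (j + 2)).Finite :=
    (v 2).hasFiniteSupport.preimage ((add_left_injective (2 : ℤ)).injOn)
  refine (((v 0).hasFiniteSupport.union h1).union h2).subset ?_
  intro j hj
  by_contra hc
  simp only [Set.mem_union, Function.mem_support, not_or, not_not] at hc
  apply hj
  simp [gammaTerm, epsilon, hc.1.1, hc.1.2, hc.2]

/-- `γ_k = ∑_{j ≤ k} (2 ε_{0,j} - 2 ε_{1,j+1} + ε_{2,j+2})`; by column-finiteness only finitely many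
summands are nonzero on a given diagram. -/
def gamma (k : ℤ) : Diagram →ₗ[ℚ] ℚ where
  toFun v := ∑ᶠ j ∈ Set.Iic k, gammaTerm j v
  map_add' v w := by
    simp only [map_add]
    exact finsum_mem_add_distrib' ((gammaTerm_support_finite v).subset Set.inter_subset_right)
      ((gammaTerm_support_finite w).subset Set.inter_subset_right)
  map_smul' c v := by
    simp only [map_smul, smul_eq_mul, RingHom.id_apply]
    simp only [← smul_eq_mul, smul_finsum]

/-- The intersection of the halfspaces `ε_{i,j} ≥ 0` (`i = 0` or `2`, `j ∈ ℤ`), `α_k ≥ 0`,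
`γ_k ≥ 0` (`k ∈ ℤ`) and `±(ε_{i,j} - ε_{i+1,j+1}) ≥ 0` (`i ≥ 2`, `j ∈ ℤ`). -/
def facetCone : Set Diagram :=
  {v | (∀ i : ℕ, i = 0 ∨ i = 2 → ∀ j : ℤ, 0 ≤ epsilon i j v) ∧
    (∀ k : ℤ, 0 ≤ alpha k v) ∧
    (∀ k : ℤ, 0 ≤ gamma k v) ∧
    (∀ i : ℕ, 2 ≤ i → ∀ j : ℤ,
      0 ≤ (epsilon i j - epsilon (i + 1) (j + 1)) v ∧
      0 ≤ (-(epsilon i j - epsilon (i + 1) (j + 1))) v)}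

/-- All the inequalities `ε_{i,j} ≥ 0` follow from those that define `facetCone`. -/
theorem epsilon_nonneg_of_mem_facetCone {v : Diagram} (hv : v ∈ facetCone) (i : ℕ) (j : ℤ) :
    0 ≤ epsilon i j v := by
  obtain ⟨he, ha, -, hp⟩ := hv
  have key : ∀ n : ℕ, ∀ j : ℤ, 0 ≤ epsilon (n + 2) j v := by
    intro n
    induction n with
    | zero => exact he 2 (Or.inr rfl)
    | succ n ih =>
      intro j
      have h := (hp (n + 2) (by omega) (j - 1)).2
      have h' := ih (j - 1)
      simp only [LinearMap.neg_apply, LinearMap.sub_apply, sub_add_cancel] at h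
      have e : n + 1 + 2 = n + 2 + 1 := by omega
      rw [e]
      linarith
  rcases i with _ | _ | i
  · exact he 0 (Or.inl rfl) j
  · have h := ha j
    have h' := he 2 (Or.inr rfl) (j + 1)
    simp only [alpha, LinearMap.sub_apply] at h
    simp only [zero_add]
    linarith
  · exact key i j

end QuadricBetti

end

/-! The ring `R` is controlled by one linear form. A nonzero quadratic form does not vanish at every
point of the plane, so choose `β` with `q(β) ≠ 0`, let `l` be the linear form vanishing at `β`, and
let `m` be one with value `1` there. Then `l` is regular on `R`, `R` is free over `k[l]` on `1, m`,
and `m ^ 2 = l * s`; modulo `l` the ring becomes the dual numbers `k[m]/(m ^ 2)`. The structure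
`LinearParameter` records exactly this, and everything after its construction uses only it.

Betti diagrams satisfy the inequalities. Modulo `l`, a minimal differential is `m` times a scalar
matrix, the `linearPart`. Regularity of `l` makes this matrix injective from `F 2 → F 1` on and
surjective from `F 3 → F 2` on. It only joins basis vectors whose degrees differ by one, so
comparing dimensions of its blocks gives `α_k ≥ 0` and the periodicity of the columns from the
second on. For `γ_k`, count dimensions in degree `k + 2` (`two_mul_card_le`): each basis vector of
lower degree contributes two dimensions, while the image of `F 2` is spanned by powers of `l` times
images of basis vectors, one for each basis vector of degree at most `k + 2`, because `m * d x`
always has the form `l * d u`.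

The inequalities give a decomposition into pure diagrams. A point of the facet cone is determined by
column zero `p`, the periodic part `t`, and the excess `f` of column one over `t`. The conditions
`γ_k ≥ 0` say that the supply `p` dominates the demand `f + t / 2`, where supply in a row serves
demand in strictly higher-numbered rows. A greedy transport of supply to demand is a decomposition
(`assemble_mem_pureCone`).

Pure diagrams are Betti diagrams: they are realized by shifts of `R`, `R/(l ^ n)` and `R/(l ^ n *
(m, l))`, the last resolved periodically by a matrix factorization. -/

noncomputable section

namespace QuadricBetti

open MvPolynomial

/-! ### Gradings of quotient rings -/

section Quotient

variable {σ A : Type*} [CommRing A] [SetLike σ A] [AddSubgroupClass σ A]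
  (𝒜 : ℤ → σ) [GradedRing 𝒜]

/-- The quotient of a graded ring by a homogeneous ideal, shifted by `e`, is graded. -/
theorem isInternal_quotient {I : Ideal A} (hI : I.IsHomogeneous 𝒜) (e : ℤ)
    (ℳ : ℤ → AddSubgroup (A ⧸ I))
    (hℳ : ∀ j x, x ∈ ℳ j ↔ ∃ a ∈ 𝒜 (j - e), Ideal.Quotient.mk I a = x) :
    DirectSum.IsInternal ℳ := by
  classical
  constructor
  · rw [injective_iff_map_eq_zero]
    intro x hx
    choose f hf hfx using fun j => (hℳ j (x j)).1 (x j).2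
    have hsum : ∑ i ∈ x.support, f i ∈ I := by
      rw [← Ideal.Quotient.eq_zero_iff_mem, map_sum, ← hx,
        DirectSum.coeAddMonoidHom_eq_dfinsuppSum, DFinsupp.sum]
      exact Finset.sum_congr rfl fun i _ => hfx i
    ext j
    rw [DirectSum.zero_apply, ZeroMemClass.coe_zero]
    by_cases hj : j ∈ x.support
    · have h := hI (j - e) hsum
      rw [DirectSum.decompose_sum, DFinsupp.finsetSum_apply, AddSubmonoidClass.coe_finsetSum,
        Finset.sum_eq_single j, DirectSum.decompose_of_mem_same 𝒜 (hf j)] at h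
      · rw [← hfx j, Ideal.Quotient.eq_zero_iff_mem]
        exact h
      · intro i _ hij
        exact DirectSum.decompose_of_mem_ne 𝒜 (hf i) (by omega)
      · exact fun h => absurd hj h
    · simpa using hj
  · intro x
    obtain ⟨a, rfl⟩ := Ideal.Quotient.mk_surjective x
    induction a using DirectSum.Decomposition.inductionOn 𝒜 with
    | zero => exact ⟨0, by simp⟩
    | @homogeneous i m =>
      refine ⟨DirectSum.of (fun j => ℳ j) (i + e) ⟨Ideal.Quotient.mk I m, ?_⟩, ?_⟩
      · exact (hℳ _ _).2 ⟨m, by simp, rfl⟩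
      · simp
    | add a b ha hb =>
      obtain ⟨y, hy⟩ := ha
      obtain ⟨z, hz⟩ := hb
      exact ⟨y + z, by rw [map_add, hy, hz, map_add]⟩

end Quotient

section QuadricRing

variable {k : Type u} [Field k] (q : MvPolynomial (Fin 2) k)

theorem mem_quadricGrading_iff {j : ℤ} {x : QuadricRing q} :
    x ∈ quadricGrading q j ↔
      ∃ p : MvPolynomial (Fin 2) k, IsWeightedHomogeneous (fun _ => (1 : ℤ)) p j ∧
        Ideal.Quotient.mk (Ideal.span {q}) p = x :=
  Iff.rfl

theorem weight_one_eq_degree (d : Fin 2 →₀ ℕ) :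
    Finsupp.weight (fun _ : Fin 2 => (1 : ℤ)) d = d.degree := by
  simp [Finsupp.weight_apply, Finsupp.degree_eq_sum, Finsupp.sum_fintype]

theorem isWeightedHomogeneous_of_isHomogeneous {q : MvPolynomial (Fin 2) k} {n : ℕ}
    (hq : q.IsHomogeneous n) : IsWeightedHomogeneous (fun _ => (1 : ℤ)) q n := by
  intro d hd
  rw [weight_one_eq_degree]
  by_contra hne
  exact hd (hq.coeff_eq_zero fun h => hne (by rw [h]))

theorem quadricGrading_gradedMonoid : SetLike.GradedMonoid (quadricGrading q) where
  one_mem := (mem_quadricGrading_iff q).2 ⟨1, isWeightedHomogeneous_one _ _, map_one _⟩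
  mul_mem := by
    rintro i j _ _ ⟨a, ha, rfl⟩ ⟨b, hb, rfl⟩
    exact (mem_quadricGrading_iff q).2
      ⟨a * b, IsWeightedHomogeneous.mul ha hb, map_mul (Ideal.Quotient.mk _) _ _⟩

theorem isInternal_quadricGrading {q : MvPolynomial (Fin 2) k} {n : ℕ}
    (hq : q.IsHomogeneous n) : DirectSum.IsInternal (quadricGrading q) := by
  let _ := weightedGradedAlgebra k (fun _ : Fin 2 => (1 : ℤ))
  refine isInternal_quotient (weightedHomogeneousSubmodule k (fun _ : Fin 2 => (1 : ℤ)))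
    (I := Ideal.span {q}) ?_ 0 _ ?_
  · refine Ideal.homogeneous_span _ _ ?_
    rintro x rfl
    exact ⟨n, isWeightedHomogeneous_of_isHomogeneous hq⟩
  · intro j x
    rw [sub_zero]
    rfl

/-- The grading of the quadric ring. -/
@[reducible] def quadricGradedRing {q : MvPolynomial (Fin 2) k} {n : ℕ}
    (hq : q.IsHomogeneous n) : GradedRing (quadricGrading q) where
  toDecomposition := (isInternal_quadricGrading hq).chooseDecomposition
  toGradedMonoid := quadricGrading_gradedMonoid q

end QuadricRing

/-! ### Linear parameters -/

/-- A graded `k`-algebra that is free with basis `1, m` over a polynomial ring `k[l]`, where `l` and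
`m` have degree one and `m ^ 2 = l * s` with `s` of degree one. -/
structure LinearParameter (k : Type*) {A : Type*} [Field k] [CommRing A] [Algebra k A]
    (𝒜 : ℤ → AddSubgroup A) where
  l : A
  m : A
  s : A
  l_mem : l ∈ 𝒜 1
  m_mem : m ∈ 𝒜 1
  s_mem : s ∈ 𝒜 1
  mul_self : m * m = l * s
  algebraMap_mem : ∀ c : k, algebraMap k A c ∈ 𝒜 0
  of_neg : ∀ j < 0, ∀ a ∈ 𝒜 j, a = 0
  of_zero : ∀ a ∈ 𝒜 0, ∃ c : k, a = algebraMap k A c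
  of_succ : ∀ n : ℕ, ∀ a ∈ 𝒜 (n + 1), ∃ c c' : k, a = c • l ^ (n + 1) + c' • (l ^ n * m)
  regular : ∀ a, l * a = 0 → a = 0
  indep : ∀ (c c' : k) (a : A), algebraMap k A c + c' • m = l * a → c = 0 ∧ c' = 0

/-! ### Existence of a linear parameter in the quadric ring. -/

section Construction

variable {k : Type u} [Field k]

/-- The restriction of polynomials to the line through `β`. -/
def restrictLine (β : Fin 2 → k) : MvPolynomial (Fin 2) k →ₐ[k] Polynomial k :=
  aeval fun i => Polynomial.C (β i) * Polynomial.X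

theorem restrictLine_of_isHomogeneous (β : Fin 2 → k) {q : MvPolynomial (Fin 2) k} {n : ℕ}
    (hq : q.IsHomogeneous n) :
    restrictLine β q = Polynomial.C (eval β q) * Polynomial.X ^ n := by
  rw [restrictLine, aeval_def, eval₂_eq', eval_eq', map_sum, Finset.sum_mul]
  refine Finset.sum_congr rfl fun d hd => ?_
  have hdeg : d 0 + d 1 = n := by
    by_contra hne
    refine mem_support_iff.1 hd (hq.coeff_eq_zero fun h => hne ?_)
    simpa [Finsupp.degree_eq_sum] using h
  simp only [Fin.prod_univ_two, Polynomial.algebraMap_eq, map_mul, map_pow, mul_pow, ← hdeg,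
    pow_add]
  ring

/-- A linear form vanishing on the line through `β`. -/
def lineForm (β : Fin 2 → k) : MvPolynomial (Fin 2) k := C (β 1) * X 0 - C (β 0) * X 1

/-- The linear form with coefficients `w`. -/
def dualForm (w : Fin 2 → k) : MvPolynomial (Fin 2) k := C (w 0) * X 0 + C (w 1) * X 1

theorem restrictLine_lineForm (β : Fin 2 → k) : restrictLine β (lineForm β) = 0 := by
  simp [restrictLine, lineForm]
  ring

theorem restrictLine_dualForm {β w : Fin 2 → k} (h : w 0 * β 0 + w 1 * β 1 = 1) :
    restrictLine β (dualForm w) = Polynomial.X := by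
  have h' := congrArg (Polynomial.C (R := k)) h
  simp only [map_add, map_mul, map_one] at h'
  simp [restrictLine, dualForm]
  linear_combination Polynomial.X * h'

theorem X_eq_lineForm_add {β w : Fin 2 → k} (h : w 0 * β 0 + w 1 * β 1 = 1) (i : Fin 2) :
    ∃ c : k, (X i : MvPolynomial (Fin 2) k) = C c * lineForm β + C (β i) * dualForm w := by
  have h' := congrArg (C (R := k) (σ := Fin 2)) h
  simp only [map_add, map_mul, map_one] at h'
  fin_cases i
  · refine ⟨w 1, ?_⟩
    simp only [lineForm, dualForm, Fin.zero_eta]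
    linear_combination -X 0 * h'
  · refine ⟨-w 0, ?_⟩
    simp only [lineForm, dualForm, Fin.mk_one, map_neg]
    linear_combination -X 1 * h'

/-- Modulo the form vanishing on the line, each variable `X i` is `β i` times the dual form, so a
polynomial is recovered from its restriction by substituting the dual form. Consequently the kernel
of restriction is generated by `lineForm β`. -/
theorem lineForm_dvd_sub {β w : Fin 2 → k} (h : w 0 * β 0 + w 1 * β 1 = 1)
    (f : MvPolynomial (Fin 2) k) :
    lineForm β ∣ f - Polynomial.aeval (dualForm w) (restrictLine β f) := by
  induction f using MvPolynomial.induction_on with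
  | C a => simp [restrictLine]
  | add f g hf hg =>
    rw [map_add, map_add, add_sub_add_comm]
    exact dvd_add hf hg
  | mul_X f i hf =>
    obtain ⟨c, hc⟩ := X_eq_lineForm_add h i
    have hX : Polynomial.aeval (dualForm w) (restrictLine β (X i)) =
        C (β i) * dualForm w := by
      simp [restrictLine, MvPolynomial.algebraMap_eq]
    rw [map_mul, map_mul, hX]
    have e : f * X i - Polynomial.aeval (dualForm w) (restrictLine β f) * (C (β i) * dualForm w) =
        (f - Polynomial.aeval (dualForm w) (restrictLine β f)) * (C (β i) * dualForm w) +
          lineForm β * (f * C c) := by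
      rw [hc]
      ring
    rw [e]
    exact dvd_add (hf.mul_right _) (dvd_mul_right _ _)

theorem lineForm_dvd_of_restrictLine_eq_zero {β w : Fin 2 → k}
    (h : w 0 * β 0 + w 1 * β 1 = 1) {f : MvPolynomial (Fin 2) k} (hf : restrictLine β f = 0) :
    lineForm β ∣ f := by
  simpa [hf] using lineForm_dvd_sub h f

/-- A form whose degree is at most the number of elements of the field is zero once it vanishes at
every point. Degree two is therefore harmless even over the field with two elements, and no
extension of `k` is needed. -/
theorem exists_eval_ne_zero {q : MvPolynomial (Fin 2) k} (hq : q.IsHomogeneous 2) (hq0 : q ≠ 0) :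
    ∃ β : Fin 2 → k, eval β q ≠ 0 := by
  by_contra! hc
  refine hq0 (hq.eq_zero_of_forall_eval_eq_zero_of_le_card hc ?_)
  exact_mod_cast Cardinal.two_le_iff.2 ⟨(0 : k), 1, zero_ne_one⟩

theorem exists_dual {β : Fin 2 → k} (hβ : β ≠ 0) :
    ∃ w : Fin 2 → k, w 0 * β 0 + w 1 * β 1 = 1 := by
  by_cases h0 : β 0 = 0
  · have h1 : β 1 ≠ 0 := fun h1 => hβ (by ext i; fin_cases i <;> simp [h0, h1])
    exact ⟨![0, (β 1)⁻¹], by simp [h1]⟩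
  · exact ⟨![(β 0)⁻¹, 0], by simp [h0]⟩

/-- A device for bounding graded pieces from above: candidate subspaces `V n` that are stable under
multiplication by the variables contain the images of all forms of degree `n`. -/
theorem mem_of_monomial {A : Type*} [CommRing A] [Algebra k A]
    (φ : MvPolynomial (Fin 2) k →ₐ[k] A) (V : ℕ → Submodule k A) (h1 : 1 ∈ V 0)
    (hX : ∀ n i, ∀ a ∈ V n, φ (X i) * a ∈ V (n + 1)) (d : Fin 2 →₀ ℕ) (r : k) :
    φ (monomial d r) ∈ V d.degree := by
  have key : ∀ a b : ℕ, φ (X 0) ^ a * φ (X 1) ^ b ∈ V (a + b) := by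
    intro a b
    induction a with
    | zero =>
      induction b with
      | zero => simpa using h1
      | succ b ih =>
        have := hX _ 1 _ ih
        rw [pow_zero, one_mul] at this ⊢
        rw [pow_succ', ← add_assoc]
        exact this
    | succ a ih =>
      have := hX _ 0 _ ih
      rw [pow_succ', mul_assoc, add_right_comm]
      exact this
  have hd : monomial d r = C r * (X 0 ^ d 0 * X 1 ^ d 1 : MvPolynomial (Fin 2) k) := by
    rw [monomial_eq, Finsupp.prod_fintype _ _ (by simp), Fin.prod_univ_two]
  rw [hd, map_mul, ← algebraMap_eq, AlgHom.commutes, ← Algebra.smul_def, map_mul, map_pow, map_pow,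
    Finsupp.degree_eq_sum, Fin.sum_univ_two]
  exact Submodule.smul_mem _ _ (key _ _)

theorem mem_of_isWeightedHomogeneous {A : Type*} [CommRing A] [Algebra k A]
    (φ : MvPolynomial (Fin 2) k →ₐ[k] A) (V : ℕ → Submodule k A) (h1 : 1 ∈ V 0)
    (hX : ∀ n i, ∀ a ∈ V n, φ (X i) * a ∈ V (n + 1)) (n : ℕ) (p : MvPolynomial (Fin 2) k)
    (hp : IsWeightedHomogeneous (fun _ => (1 : ℤ)) p n) : φ p ∈ V n := by
  rw [p.as_sum, map_sum]
  refine Submodule.sum_mem _ fun d hd => ?_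
  have h := hp (mem_support_iff.1 hd)
  rw [weight_one_eq_degree, Nat.cast_inj] at h
  exact h ▸ mem_of_monomial φ V h1 hX d _

theorem isWeightedHomogeneous_C_mul_X (c : k) (i : Fin 2) :
    IsWeightedHomogeneous (fun _ : Fin 2 => (1 : ℤ)) (C c * X i) 1 := by
  simpa using (isWeightedHomogeneous_X k (fun _ : Fin 2 => (1 : ℤ)) i).C_mul c

theorem mk_eq_algebraMap (q : MvPolynomial (Fin 2) k) (c : k) :
    Ideal.Quotient.mk (Ideal.span {q}) (C c) = algebraMap k (QuadricRing q) c :=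
  rfl

theorem smul_eq_algebraMap_mul (q : MvPolynomial (Fin 2) k) (c : k) (a : QuadricRing q) :
    c • a = algebraMap k (QuadricRing q) c * a :=
  Algebra.smul_def c a

theorem exists_mk_eq_combination (q : MvPolynomial (Fin 2) k) {β w : Fin 2 → k}
    (h : w 0 * β 0 + w 1 * β 1 = 1) (i : Fin 2) :
    ∃ c c' : k, Ideal.Quotient.mk (Ideal.span {q}) (X i) =
      c • Ideal.Quotient.mk (Ideal.span {q}) (lineForm β) +
        c' • Ideal.Quotient.mk (Ideal.span {q}) (dualForm w) := by
  obtain ⟨c, hc⟩ := X_eq_lineForm_add h i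
  refine ⟨c, β i, ?_⟩
  rw [hc, map_add, map_mul, map_mul, mk_eq_algebraMap, mk_eq_algebraMap,
    smul_eq_algebraMap_mul, smul_eq_algebraMap_mul]

theorem mem_span_of_mem_quadricGrading_one (q : MvPolynomial (Fin 2) k) {β w : Fin 2 → k}
    (h : w 0 * β 0 + w 1 * β 1 = 1) {a : QuadricRing q} (ha : a ∈ quadricGrading q 1) :
    a ∈ Submodule.span k {Ideal.Quotient.mk (Ideal.span {q}) (lineForm β),
      Ideal.Quotient.mk (Ideal.span {q}) (dualForm w)} := by
  obtain ⟨p, hp, rfl⟩ := ha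
  -- Only degree one matters here, so the candidates from degree two on may be the whole ring.
  let V : ℕ → Submodule k (QuadricRing q)
    | 0 => Submodule.span k {1}
    | 1 => Submodule.span k {Ideal.Quotient.mk (Ideal.span {q}) (lineForm β),
        Ideal.Quotient.mk (Ideal.span {q}) (dualForm w)}
    | _ + 2 => ⊤
  refine mem_of_isWeightedHomogeneous (Ideal.Quotient.mkₐ k (Ideal.span {q})) V
    (Submodule.mem_span_singleton_self _) ?_ 1 p hp
  rintro (_ | n) i a ha
  · obtain ⟨c, rfl⟩ := Submodule.mem_span_singleton.1 ha
    obtain ⟨c', c'', h'⟩ := exists_mk_eq_combination q h i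
    rw [mul_smul_comm, mul_one]
    refine Submodule.smul_mem _ _ (Submodule.mem_span_pair.2 ⟨c', c'', ?_⟩)
    exact h'.symm
  · exact Submodule.mem_top

/-- Restricting `q` to the line through `β` gives `q(β) * X ^ 2`, hence `q = q(β) * m ^ 2 + l * g`.
The nonzero coefficient `q(β)` lets this relation be solved for `m ^ 2` in the quotient, and
restriction to the line also yields regularity and independence. -/
theorem exists_linearParameter {q : MvPolynomial (Fin 2) k} (hq : q.IsHomogeneous 2)
    (hq0 : q ≠ 0) : Nonempty (LinearParameter k (quadricGrading q)) := by
  let _ := quadricGradedRing hq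
  obtain ⟨β, hβ⟩ := exists_eval_ne_zero hq hq0
  have hβ0 : β ≠ 0 := by
    rintro rfl
    apply hβ
    rw [eval_eq']
    refine Finset.sum_eq_zero fun d hd => ?_
    have hd' : d.degree = 2 := by
      by_contra hne
      exact mem_support_iff.1 hd (hq.coeff_eq_zero hne)
    rw [Finsupp.degree_eq_sum, Fin.sum_univ_two] at hd'
    rw [Fin.prod_univ_two]
    by_cases h0 : d 0 = 0
    · have h1 : d 1 ≠ 0 := by omega
      simp [h1]
    · simp [h0]
  obtain ⟨w, hw⟩ := exists_dual hβ0
  set π := Ideal.Quotient.mk (Ideal.span {q}) with hπ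
  have hl : π (lineForm β) ∈ quadricGrading q 1 :=
    ⟨_, (isWeightedHomogeneous_C_mul_X _ _).sub (isWeightedHomogeneous_C_mul_X _ _), rfl⟩
  have hm : π (dualForm w) ∈ quadricGrading q 1 :=
    ⟨_, (isWeightedHomogeneous_C_mul_X _ _).add (isWeightedHomogeneous_C_mul_X _ _), rfl⟩
  have hτ := restrictLine_of_isHomogeneous β hq
  obtain ⟨g, hg⟩ := lineForm_dvd_sub hw q
  obtain ⟨s, hs, hms⟩ : ∃ s ∈ quadricGrading q 1,
      π (dualForm w) * π (dualForm w) = π (lineForm β) * s := by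
    have h1 : π (dualForm w) * π (dualForm w) = π (lineForm β) * π (C (-(eval β q)⁻¹) * g) := by
      rw [← map_mul, ← map_mul, hπ, Ideal.Quotient.eq, Ideal.mem_span_singleton]
      refine ⟨C (eval β q)⁻¹, ?_⟩
      rw [hτ, map_mul, map_pow, Polynomial.aeval_C, Polynomial.aeval_X, algebraMap_eq] at hg
      have hc : (C (eval β q) * C (eval β q)⁻¹ : MvPolynomial (Fin 2) k) = 1 := by
        rw [← map_mul, mul_inv_cancel₀ hβ, map_one]
      rw [map_neg]
      linear_combination -C (eval β q)⁻¹ * hg - (dualForm w) ^ 2 * hc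
    -- The cofactor `g` is not known to be homogeneous. Its component of degree one still works:
    -- compare components of degree two on both sides.
    refine ⟨_, SetLike.coe_mem (DirectSum.decompose (quadricGrading q) (π (C (-(eval β q)⁻¹) * g)) 1),
      ?_⟩
    have h2 := congrArg (fun a => (DirectSum.decompose (quadricGrading q) a (1 + 1) : QuadricRing q))
      h1
    rwa [DirectSum.decompose_of_mem_same _ (SetLike.mul_mem_graded hm hm),
      DirectSum.coe_decompose_mul_add_of_left_mem _ hl] at h2
  refine ⟨⟨π (lineForm β), π (dualForm w), s, hl, hm, hs, hms, ?_, ?_, ?_, ?_, ?_, ?_⟩⟩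
  · exact fun c => ⟨C c, isWeightedHomogeneous_C _ _, rfl⟩
  · rintro j hj a ⟨p, hp, rfl⟩
    have : p = 0 := by
      ext d
      by_contra hd
      have := hp hd
      rw [weight_one_eq_degree] at this
      omega
    rw [this, map_zero]
  · rintro a ⟨p, hp, rfl⟩
    refine ⟨coeff 0 p, ?_⟩
    have : p = C (coeff 0 p) := by
      ext d
      rw [coeff_C]
      split_ifs with h0
      · rw [h0]
      · by_contra hd
        have := hp hd
        rw [weight_one_eq_degree, Nat.cast_eq_zero, Finsupp.degree_eq_zero_iff] at this
        exact h0 this.symm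
    conv_lhs => rw [this]
    rfl
  -- Writing `s` as a combination of `l` and `m` turns `m ^ 2 = l * s` into a rewriting rule that
  -- keeps `l ^ n * m * m` in the span of `l ^ (n + 2)` and `l ^ (n + 1) * m`.
  · obtain ⟨c, c', hcs⟩ := Submodule.mem_span_pair.1 (mem_span_of_mem_quadricGrading_one q hw hs)
    let V : ℕ → Submodule k (QuadricRing q)
      | 0 => Submodule.span k {1}
      | n + 1 => Submodule.span k {π (lineForm β) ^ (n + 1), π (lineForm β) ^ n * π (dualForm w)}
    rintro n a ⟨p, hp, rfl⟩
    have hp' := mem_of_isWeightedHomogeneous (Ideal.Quotient.mkₐ k (Ideal.span {q})) V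
      (Submodule.mem_span_singleton_self _) ?_ (n + 1) p (by exact_mod_cast hp)
    · obtain ⟨e, e', he⟩ := Submodule.mem_span_pair.1 hp'
      exact ⟨e, e', he.symm⟩
    rintro (_ | n) i a ha <;> obtain ⟨e, e', h'⟩ := exists_mk_eq_combination q hw i
    · obtain ⟨r, rfl⟩ := Submodule.mem_span_singleton.1 ha
      rw [mul_smul_comm, mul_one]
      refine Submodule.smul_mem _ _ (Submodule.mem_span_pair.2 ⟨e, e', ?_⟩)
      rw [Nat.zero_add, pow_one, pow_zero, one_mul]
      exact h'.symm
    · obtain ⟨r, r', rfl⟩ := Submodule.mem_span_pair.1 ha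
      refine Submodule.mem_span_pair.2 ⟨e * r + e' * r' * c, e * r' + e' * r + e' * r' * c', ?_⟩
      refine Eq.trans ?_ (congrArg (· * _) h'.symm)
      simp only [smul_eq_algebraMap_mul, map_add, map_mul] at hcs ⊢
      rw [← hcs] at hms
      linear_combination -(algebraMap k _ e' * algebraMap k _ r' * π (lineForm β) ^ n) * hms
  -- If `l * f = q * r`, restriction to the line kills the left side while `q` restricts to a
  -- nonzero polynomial. So `r` restricts to zero, `l` divides `r`, and `l` can be cancelled.
  · intro a ha
    obtain ⟨f, rfl⟩ := Ideal.Quotient.mk_surjective a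
    rw [← hπ, ← map_mul, hπ, Ideal.Quotient.eq_zero_iff_mem, Ideal.mem_span_singleton] at ha
    obtain ⟨r, hr⟩ := ha
    have h1 := congrArg (restrictLine β) hr
    rw [map_mul, map_mul, restrictLine_lineForm, zero_mul, hτ, eq_comm, mul_eq_zero] at h1
    obtain ⟨r', rfl⟩ := lineForm_dvd_of_restrictLine_eq_zero hw
      (h1.resolve_left (by simp [hβ]))
    have hL : lineForm β ≠ 0 := by
      intro h0
      apply hβ0
      have e0 := congrArg (coeff (Finsupp.single 0 1)) h0
      have e1 := congrArg (coeff (Finsupp.single 1 1)) h0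
      simp [lineForm, coeff_C_mul, coeff_X, Finsupp.single_left_inj] at e0 e1
      ext i
      fin_cases i <;> simp [e0, e1]
    rw [Ideal.Quotient.eq_zero_iff_mem, Ideal.mem_span_singleton]
    exact ⟨r', mul_left_cancel₀ hL (by rw [hr]; ring)⟩
  -- On the line the relation reads `c + c' * X = q(β) * X ^ 2 * r`; compare the coefficients of
  -- degrees zero and one.
  · intro c c' a ha
    obtain ⟨f, rfl⟩ := Ideal.Quotient.mk_surjective a
    rw [Algebra.smul_def, ← mk_eq_algebraMap, ← mk_eq_algebraMap, ← hπ, ← map_mul, ← map_add,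
      ← map_mul, hπ, Ideal.Quotient.eq, Ideal.mem_span_singleton] at ha
    obtain ⟨r, hr⟩ := ha
    have h1 := congrArg (restrictLine β) hr
    rw [map_sub, map_add, map_mul, map_mul, map_mul, restrictLine_lineForm, zero_mul, hτ,
      restrictLine_dualForm hw, sub_zero, ← algebraMap_eq, AlgHom.commutes, AlgHom.commutes,
      Polynomial.algebraMap_eq] at h1
    have e0 := congrArg (Polynomial.coeff · 0) h1
    have e1 := congrArg (Polynomial.coeff · 1) h1
    have hx : (Polynomial.C (eval β q) * Polynomial.X ^ 2 * restrictLine β r : Polynomial k) =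
        (Polynomial.C (eval β q) * restrictLine β r) * Polynomial.X ^ 2 := by ring
    simp only [hx, Polynomial.coeff_mul_X_pow'] at e0 e1
    simp [Polynomial.coeff_C] at e0 e1
    exact ⟨e0, e1⟩

end Construction

/-! ### Reduction modulo a linear parameter -/

namespace LinearParameter

variable {k A : Type*} [Field k] [CommRing A] [Algebra k A] {𝒜 : ℤ → AddSubgroup A}

theorem of_toNat (Λ : LinearParameter k 𝒜) {j : ℤ} (hj : 0 < j) {a : A} (ha : a ∈ 𝒜 j) :
    ∃ c c' : k, a = c • Λ.l ^ j.toNat + c' • (Λ.l ^ (j - 1).toNat * Λ.m) := by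
  obtain ⟨n, rfl⟩ : ∃ n : ℕ, j = n + 1 := ⟨(j - 1).toNat, by omega⟩
  obtain ⟨c, c', h⟩ := Λ.of_succ n a ha
  refine ⟨c, c', ?_⟩
  rw [h, show ((n : ℤ) + 1).toNat = n + 1 by omega, show ((n : ℤ) + 1 - 1).toNat = n by omega]

theorem smul_mem (Λ : LinearParameter k 𝒜) [GradedRing 𝒜] (c : k) {j : ℤ} {a : A}
    (ha : a ∈ 𝒜 j) : c • a ∈ 𝒜 j := by
  rw [Algebra.smul_def, ← zero_add j]
  exact SetLike.mul_mem_graded (Λ.algebraMap_mem c) ha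

theorem pow_mem (Λ : LinearParameter k 𝒜) [GradedRing 𝒜] (n : ℕ) : Λ.l ^ n ∈ 𝒜 n := by
  simpa using SetLike.pow_mem_graded n Λ.l_mem

theorem pow_mul_eq_zero (Λ : LinearParameter k 𝒜) (n : ℕ) {a : A} (h : Λ.l ^ n * a = 0) :
    a = 0 := by
  induction n with
  | zero => simpa using h
  | succ n ih => exact ih (Λ.regular _ (by rw [← h]; ring))

theorem eq_zero_of_smul_eq_zero (Λ : LinearParameter k 𝒜) {ι : Type*} {w : ι → A}
    (h : Λ.l • w = 0) : w = 0 :=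
  funext fun b => Λ.regular _ (congrFun h b)

theorem indep_pow (Λ : LinearParameter k 𝒜) {j : ℤ} (hj : 0 < j) {c c' : k}
    (h : c • Λ.l ^ j.toNat + c' • (Λ.l ^ (j - 1).toNat * Λ.m) = 0) : c = 0 ∧ c' = 0 := by
  obtain ⟨n, rfl⟩ : ∃ n : ℕ, j = n + 1 := ⟨(j - 1).toNat, by omega⟩
  rw [show ((n : ℤ) + 1).toNat = n + 1 by omega, show ((n : ℤ) + 1 - 1).toNat = n by omega] at h
  simp only [Algebra.smul_def] at h
  have h1 : Λ.l * algebraMap k A c + algebraMap k A c' * Λ.m = 0 :=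
    Λ.pow_mul_eq_zero n (by rw [← h]; ring)
  have h2 := Λ.indep 0 c' (-algebraMap k A c) (by
    rw [map_zero, Algebra.smul_def]; linear_combination h1)
  refine ⟨?_, h2.2⟩
  rw [h2.2, map_zero, zero_mul, add_zero] at h1
  exact (Λ.indep c 0 0 (by rw [Λ.regular _ h1]; simp)).1

theorem exists_eq_add (Λ : LinearParameter k 𝒜) [GradedRing 𝒜] (a : A) :
    ∃ p : k × k, ∃ b : A, a = algebraMap k A p.1 + p.2 • Λ.m + Λ.l * b := by
  induction a using DirectSum.Decomposition.inductionOn 𝒜 with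
  | zero => exact ⟨0, 0, by simp⟩
  | @homogeneous i m =>
    obtain ⟨a, ha⟩ := m
    rcases lt_trichotomy i 0 with hi | rfl | hi
    · exact ⟨0, 0, by simp [Λ.of_neg i hi a ha]⟩
    · obtain ⟨c, hc⟩ := Λ.of_zero a ha
      exact ⟨(c, 0), 0, by simp [hc]⟩
    · obtain ⟨n, rfl⟩ : ∃ n : ℕ, i = n + 1 := ⟨(i - 1).toNat, by omega⟩
      obtain ⟨c, c', h⟩ := Λ.of_succ n a ha
      rcases n with _ | n
      · refine ⟨(0, c'), algebraMap k A c, ?_⟩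
        simp only [h, Algebra.smul_def, map_zero]
        ring
      · refine ⟨0, c • Λ.l ^ (n + 1) + c' • (Λ.l ^ n * Λ.m), ?_⟩
        simp only [h, Algebra.smul_def, map_zero, Prod.fst_zero, Prod.snd_zero]
        ring
  | add a a' h h' =>
    obtain ⟨p, b, hp⟩ := h
    obtain ⟨p', b', hp'⟩ := h'
    refine ⟨p + p', b + b', ?_⟩
    rw [hp, hp']
    simp only [Prod.fst_add, Prod.snd_add, map_add, add_smul]
    ring

/-- The coefficients of `1` and `m` modulo `l`. -/
def coeffs (Λ : LinearParameter k 𝒜) [GradedRing 𝒜] (a : A) : k × k :=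
  (Λ.exists_eq_add a).choose

variable (Λ : LinearParameter k 𝒜) [GradedRing 𝒜]

theorem coeffs_spec (a : A) :
    ∃ b, a = algebraMap k A (Λ.coeffs a).1 + (Λ.coeffs a).2 • Λ.m + Λ.l * b :=
  (Λ.exists_eq_add a).choose_spec

theorem coeffs_eq {a : A} {c c' : k} (b : A)
    (h : a = algebraMap k A c + c' • Λ.m + Λ.l * b) : Λ.coeffs a = (c, c') := by
  obtain ⟨b', hb'⟩ := Λ.coeffs_spec a
  have := Λ.indep ((Λ.coeffs a).1 - c) ((Λ.coeffs a).2 - c') (b - b') (by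
    rw [map_sub, sub_smul]
    linear_combination h - hb')
  exact Prod.ext (sub_eq_zero.1 this.1) (sub_eq_zero.1 this.2)

/-- The coefficient of `1` modulo `l`. -/
def fst : A →+ k where
  toFun a := (Λ.coeffs a).1
  map_zero' := by rw [Λ.coeffs_eq (c := 0) (c' := 0) 0 (by simp)]
  map_add' a a' := by
    obtain ⟨b, hb⟩ := Λ.coeffs_spec a
    obtain ⟨b', hb'⟩ := Λ.coeffs_spec a'
    rw [Λ.coeffs_eq (a := a + a') (b + b') (by
      nth_rw 1 [hb, hb']
      rw [add_add_add_comm, add_add_add_comm (algebraMap k A _), ← map_add, ← add_smul, mul_add])]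

/-- The coefficient of `m` modulo `l`. -/
def snd : A →+ k where
  toFun a := (Λ.coeffs a).2
  map_zero' := by rw [Λ.coeffs_eq (c := 0) (c' := 0) 0 (by simp)]
  map_add' a a' := by
    obtain ⟨b, hb⟩ := Λ.coeffs_spec a
    obtain ⟨b', hb'⟩ := Λ.coeffs_spec a'
    rw [Λ.coeffs_eq (a := a + a') (b + b') (by
      nth_rw 1 [hb, hb']
      rw [add_add_add_comm, add_add_add_comm (algebraMap k A _), ← map_add, ← add_smul, mul_add])]

theorem spec (a : A) : ∃ b, a = algebraMap k A (Λ.fst a) + Λ.snd a • Λ.m + Λ.l * b :=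
  Λ.coeffs_spec a

theorem fst_eq {a : A} {c c' : k} (b : A)
    (h : a = algebraMap k A c + c' • Λ.m + Λ.l * b) : Λ.fst a = c :=
  congrArg Prod.fst (Λ.coeffs_eq b h)

theorem snd_eq {a : A} {c c' : k} (b : A)
    (h : a = algebraMap k A c + c' • Λ.m + Λ.l * b) : Λ.snd a = c' :=
  congrArg Prod.snd (Λ.coeffs_eq b h)

@[simp] theorem fst_algebraMap (c : k) : Λ.fst (algebraMap k A c) = c :=
  Λ.fst_eq (c' := 0) 0 (by simp)

@[simp] theorem fst_l_mul (a : A) : Λ.fst (Λ.l * a) = 0 :=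
  Λ.fst_eq (c' := 0) a (by simp)

@[simp] theorem snd_l_mul (a : A) : Λ.snd (Λ.l * a) = 0 :=
  Λ.snd_eq (c := 0) a (by simp)

@[simp] theorem fst_l : Λ.fst Λ.l = 0 := by
  simpa using Λ.fst_l_mul 1

/-- Since `m ^ 2` is a multiple of `l`, multiplication modulo `l` is that of the dual numbers. -/
theorem mul_spec (a a' : A) : ∃ b, a * a' = algebraMap k A (Λ.fst a * Λ.fst a') +
    (Λ.fst a * Λ.snd a' + Λ.snd a * Λ.fst a') • Λ.m + Λ.l * b := by
  obtain ⟨b, hb⟩ := Λ.spec a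
  obtain ⟨b', hb'⟩ := Λ.spec a'
  refine ⟨algebraMap k A (Λ.fst a) * b' + Λ.snd a • Λ.m * b' + b * a' +
    algebraMap k A (Λ.snd a * Λ.snd a') * Λ.s, ?_⟩
  simp only [map_mul, map_add, Algebra.smul_def] at hb hb' ⊢
  linear_combination a' * hb + (algebraMap k A (Λ.fst a) + algebraMap k A (Λ.snd a) * Λ.m) * hb' +
    algebraMap k A (Λ.snd a) * algebraMap k A (Λ.snd a') * Λ.mul_self

theorem fst_mul (a a' : A) : Λ.fst (a * a') = Λ.fst a * Λ.fst a' := by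
  obtain ⟨b, hb⟩ := Λ.mul_spec a a'
  exact Λ.fst_eq b hb

theorem snd_mul (a a' : A) :
    Λ.snd (a * a') = Λ.fst a * Λ.snd a' + Λ.snd a * Λ.fst a' := by
  obtain ⟨b, hb⟩ := Λ.mul_spec a a'
  exact Λ.snd_eq b hb

@[simp] theorem fst_m : Λ.fst Λ.m = 0 := Λ.fst_eq (c' := 1) 0 (by simp)

@[simp] theorem snd_m : Λ.snd Λ.m = 1 := Λ.snd_eq (c := 0) 0 (by simp)

theorem exists_eq_l_mul {a : A} (h : Λ.fst a = 0) (h' : Λ.snd a = 0) : ∃ b, a = Λ.l * b := by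
  obtain ⟨b, hb⟩ := Λ.spec a
  exact ⟨b, by simpa [h, h'] using hb⟩

/-- In the dual numbers `m` annihilates its own multiples. -/
theorem exists_m_mul_eq {a : A} (h : Λ.fst a = 0) : ∃ b, Λ.m * a = Λ.l * b := by
  obtain ⟨b, hb⟩ := Λ.spec a
  refine ⟨Λ.snd a • Λ.s + Λ.m * b, ?_⟩
  rw [h, map_zero, zero_add, Algebra.smul_def] at hb
  rw [Algebra.smul_def]
  linear_combination Λ.m * hb + algebraMap k A (Λ.snd a) * Λ.mul_self

theorem fst_of_mem {j : ℤ} (hj : j ≠ 0) {a : A} (ha : a ∈ 𝒜 j) : Λ.fst a = 0 := by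
  rcases hj.lt_or_gt with hj | hj
  · rw [Λ.of_neg j hj a ha, map_zero]
  · obtain ⟨n, rfl⟩ : ∃ n : ℕ, j = n + 1 := ⟨(j - 1).toNat, by omega⟩
    obtain ⟨c, c', h⟩ := Λ.of_succ n a ha
    rw [h, pow_succ', Algebra.smul_def, Algebra.smul_def, map_add]
    simp [fst_mul]

theorem snd_of_mem {j : ℤ} (hj : j ≠ 1) {a : A} (ha : a ∈ 𝒜 j) : Λ.snd a = 0 := by
  rcases lt_trichotomy j 0 with hi | rfl | hi
  · rw [Λ.of_neg j hi a ha, map_zero]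
  · obtain ⟨c, rfl⟩ := Λ.of_zero a ha
    exact Λ.snd_eq (c := c) 0 (by simp)
  · obtain ⟨n, rfl⟩ : ∃ n : ℕ, j = (n + 1 : ℕ) + 1 := ⟨(j - 2).toNat, by omega⟩
    obtain ⟨c, c', h⟩ := Λ.of_succ (n + 1) a ha
    have e : a = Λ.l * (c • Λ.l ^ (n + 1) + c' • (Λ.l ^ n * Λ.m)) := by
      rw [h]
      simp only [Algebra.smul_def]
      ring
    rw [e, snd_l_mul]

theorem fst_of_mem_irrelevant {a : A} (ha : a ∈ irrelevant 𝒜) : Λ.fst a = 0 := by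
  induction ha using Submodule.span_induction with
  | mem a ha =>
    obtain ⟨n, hn, ha⟩ := ha
    exact Λ.fst_of_mem hn.ne' ha
  | zero => exact map_zero _
  | add a b _ _ ha hb => rw [map_add, ha, hb, add_zero]
  | smul c a _ ha => rw [smul_eq_mul, fst_mul, ha, mul_zero]

end LinearParameter

/-! ### Linear maps that respect a partition of the coordinates -/

section Coordinates

variable {k α β : Type*} [Field k] [Fintype α] [Fintype β]
  {p : α → Prop} {r : β → Prop} [DecidablePred p] [DecidablePred r]

/-- A map preserving a coordinate subspace restricts to it, and the restriction inherits
injectivity. In the surjective companion the map instead passes to quotients by coordinate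
subspaces, so the hypothesis on supports is complementary. -/
theorem card_filter_le_of_injective (f : (α → k) →ₗ[k] (β → k))
    (hf : ∀ v, (∀ a, ¬ p a → v a = 0) → ∀ b, ¬ r b → f v b = 0)
    (hinj : ∀ v, f v = 0 → v = 0) :
    (Finset.univ.filter p).card ≤ (Finset.univ.filter r).card := by
  rw [← Fintype.card_subtype, ← Fintype.card_subtype]
  refine card_le_of_injective k (LinearMap.funLeft k k (Subtype.val : {b // r b} → β) ∘ₗ f ∘ₗ
    Function.ExtendByZero.linearMap k (Subtype.val : {a // p a} → α)) ?_
  rw [injective_iff_map_eq_zero]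
  intro v hv
  have hv' : Function.extend Subtype.val v 0 = 0 := by
    refine hinj _ (funext fun b => ?_)
    by_cases hb : r b
    · exact congrFun hv ⟨b, hb⟩
    · refine hf _ (fun a ha => ?_) b hb
      exact Function.extend_apply' _ _ _ (by rintro ⟨x, rfl⟩; exact ha x.2)
  funext a
  rw [← Subtype.val_injective.extend_apply v 0 a, hv']
  rfl

theorem card_filter_le_of_surjective (f : (α → k) →ₗ[k] (β → k))
    (hf : ∀ v, (∀ a, p a → v a = 0) → ∀ b, r b → f v b = 0)
    (hsurj : Function.Surjective f) :
    (Finset.univ.filter r).card ≤ (Finset.univ.filter p).card := by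
  rw [← Fintype.card_subtype, ← Fintype.card_subtype]
  refine card_le_of_surjective k (LinearMap.funLeft k k (Subtype.val : {b // r b} → β) ∘ₗ f ∘ₗ
    Function.ExtendByZero.linearMap k (Subtype.val : {a // p a} → α)) ?_
  intro w
  obtain ⟨v, hv⟩ := hsurj (Function.extend Subtype.val w 0)
  refine ⟨fun a => v a, funext fun b => ?_⟩
  have h := hf (v - Function.extend Subtype.val (fun a : {a // p a} => v a) 0) (fun a ha => by
    simp [Subtype.val_injective.extend_apply (fun a : {a // p a} => v a) 0 ⟨a, ha⟩]) b b.2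
  rw [map_sub, Pi.sub_apply, sub_eq_zero, hv, Subtype.val_injective.extend_apply] at h
  exact h.symm

end Coordinates

/-! ### Minimal resolutions over a ring with a linear parameter -/

namespace MinimalGradedFreeResolution

section General

variable {A : Type u} [CommRing A] {𝒜 : ℤ → AddSubgroup A}
  {M : Type v} [AddCommGroup M] [Module A M] {ℳ : ℤ → AddSubgroup M}
  (F : MinimalGradedFreeResolution 𝒜 ℳ)

theorem d_apply (i : ℕ) (z : Fin (F.rank (i + 1)) → A) (b : Fin (F.rank i)) :
    F.d i z b = ∑ a, z a * F.d i (Pi.single a 1) b := by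
  conv_lhs => rw [pi_eq_sum_univ' z, map_sum]
  rw [Finset.sum_apply]
  refine Finset.sum_congr rfl fun a _ => ?_
  rw [map_smul, Pi.smul_apply, smul_eq_mul]

theorem d_apply_mem_irrelevant (i : ℕ) (z : Fin (F.rank (i + 1)) → A) (b : Fin (F.rank i)) :
    F.d i z b ∈ irrelevant 𝒜 := by
  have h := F.minimal i (LinearMap.mem_range_self (F.d i) z)
  refine Submodule.smul_induction_on h (fun r hr w _ => ?_) fun w w' hw hw' => ?_
  · exact Ideal.mul_mem_right _ _ hr
  · exact add_mem hw hw'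

theorem d_d (i : ℕ) (z) : F.d i (F.d (i + 1) z) = 0 :=
  (F.exact_succ i).apply_apply_eq_zero z

/-- The homogeneous component of degree `N` of an element of `F i`. -/
def component [GradedRing 𝒜] (i : ℕ) (N : ℤ) (z : Fin (F.rank i) → A) : Fin (F.rank i) → A :=
  fun a => (DirectSum.decompose 𝒜 (z a) (N - F.deg i a) : A)

/-- The homogeneous elements of degree `N` of `F i`. -/
def IsHomog (i : ℕ) (N : ℤ) (z : Fin (F.rank i) → A) : Prop :=
  ∀ a, z a ∈ 𝒜 (N - F.deg i a)

theorem component_isHomog [GradedRing 𝒜] (i : ℕ) (N : ℤ) (z : Fin (F.rank i) → A) :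
    F.IsHomog i N (F.component i N z) :=
  fun _ => SetLike.coe_mem _

theorem d_component [GradedRing 𝒜] (i : ℕ) (N : ℤ) (z : Fin (F.rank (i + 1)) → A) :
    F.d i (F.component (i + 1) N z) = F.component i N (F.d i z) := by
  funext b
  rw [component, d_apply, d_apply, DirectSum.decompose_sum, DFinsupp.finsetSum_apply,
    AddSubmonoidClass.coe_finsetSum]
  refine Finset.sum_congr rfl fun a _ => ?_
  rw [component, ← DirectSum.coe_decompose_mul_add_of_right_mem 𝒜 (F.d_mem i a b),
    sub_add_sub_cancel]

theorem component_of_isHomog [GradedRing 𝒜] {i : ℕ} {N : ℤ} {z : Fin (F.rank i) → A}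
    (hz : F.IsHomog i N z) : F.component i N z = z :=
  funext fun a => DirectSum.decompose_of_mem_same 𝒜 (hz a)

theorem d_isHomog [GradedRing 𝒜] {i : ℕ} {N : ℤ} {z : Fin (F.rank (i + 1)) → A}
    (hz : F.IsHomog (i + 1) N z) : F.IsHomog i N (F.d i z) := by
  rw [← F.component_of_isHomog hz, d_component]
  exact F.component_isHomog _ _ _

theorem isHomog_single [GradedRing 𝒜] (i : ℕ) (a : Fin (F.rank i)) :
    F.IsHomog i (F.deg i a) (Pi.single a 1) := by
  intro b
  rcases eq_or_ne b a with rfl | h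
  · rw [Pi.single_eq_same, sub_self]
    exact SetLike.GradedOne.one_mem
  · rw [Pi.single_eq_of_ne h]
    exact zero_mem _

/-- Differentials have degree zero and commute with taking components, so any preimage may be
replaced by its component of degree `N`. -/
theorem exists_isHomog_preimage [GradedRing 𝒜] {i : ℕ} {N : ℤ} {w : Fin (F.rank (i + 1)) → A}
    (hw : F.IsHomog (i + 1) N w) (h : F.d i w = 0) :
    ∃ z, F.IsHomog (i + 2) N z ∧ F.d (i + 1) z = w := by
  obtain ⟨z, rfl⟩ := (F.exact_succ i w).1 h
  exact ⟨_, F.component_isHomog _ _ _, by rw [d_component, F.component_of_isHomog hw]⟩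

end General

section LinearParameter

variable {k A : Type u} [Field k] [CommRing A] [Algebra k A] {𝒜 : ℤ → AddSubgroup A}
  [GradedRing 𝒜] (Λ : LinearParameter k 𝒜)
  {M : Type v} [AddCommGroup M] [Module A M] {ℳ : ℤ → AddSubgroup M}
  (F : MinimalGradedFreeResolution 𝒜 ℳ)

/-- Entries of negative degree vanish, and an entry of degree zero is a constant, which minimality
forces to be zero. -/
theorem d_single_eq_zero (Λ : LinearParameter k 𝒜) (i : ℕ) {a : Fin (F.rank (i + 1))} {b : Fin (F.rank i)}
    (h : F.deg (i + 1) a ≤ F.deg i b) : F.d i (Pi.single a 1) b = 0 := by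
  have hmem := F.d_mem i a b
  rcases h.lt_or_eq with h | h
  · exact Λ.of_neg _ (by omega) _ hmem
  · rw [h, sub_self] at hmem
    obtain ⟨c, hc⟩ := Λ.of_zero _ hmem
    have := Λ.fst_of_mem_irrelevant (F.d_apply_mem_irrelevant i (Pi.single a 1) b)
    rw [hc, Λ.fst_algebraMap] at this
    rw [hc, this, map_zero]

theorem exists_eq_l_smul {r : ℕ} {w : Fin r → A} (h : ∀ b, Λ.fst (w b) = 0)
    (h' : ∀ b, Λ.snd (w b) = 0) : ∃ w', w = Λ.l • w' := by
  choose w' hw' using fun b => Λ.exists_eq_l_mul (h b) (h' b)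
  exact ⟨w', funext hw'⟩

theorem fst_d_apply (i : ℕ) (z : Fin (F.rank (i + 1)) → A) (b : Fin (F.rank i)) :
    Λ.fst (F.d i z b) = 0 :=
  Λ.fst_of_mem_irrelevant (F.d_apply_mem_irrelevant i z b)

/-- The matrix of the coefficients of `m` in the differential modulo `l`. -/
def linearPart (i : ℕ) : (Fin (F.rank (i + 1)) → k) →ₗ[k] (Fin (F.rank i) → k) :=
  LinearMap.pi fun b => ∑ a, Λ.snd (F.d i (Pi.single a 1) b) • LinearMap.proj a

theorem linearPart_apply (i : ℕ) (v : Fin (F.rank (i + 1)) → k) (b : Fin (F.rank i)) :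
    F.linearPart Λ i v b = ∑ a, Λ.snd (F.d i (Pi.single a 1) b) * v a := by
  simp [linearPart]

/-- The entries of the differential have no constant term, so modulo `l` it is `m` times a scalar
matrix and sees only the constant terms of its argument. -/
theorem snd_d_apply (i : ℕ) (z : Fin (F.rank (i + 1)) → A) (b : Fin (F.rank i)) :
    Λ.snd (F.d i z b) = F.linearPart Λ i (fun a => Λ.fst (z a)) b := by
  rw [d_apply, map_sum, linearPart_apply]
  refine Finset.sum_congr rfl fun a _ => ?_
  rw [Λ.snd_mul, fst_d_apply, mul_zero, add_zero, mul_comm]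

/-- This is exactness modulo `l`, done by hand. Lift `v` to constants `z`. If the linear part kills
`v`, then `d z = l * w`; regularity gives `d w = 0`, so `w = d u`, and `z - l * u` is a cycle, hence
a boundary. Boundaries have no constant term, so `v = 0`. The differential `F 1 → F 0` is excluded
because `l` may be a zero divisor on the module itself. -/
theorem linearPart_injective (i : ℕ) {v : Fin (F.rank (i + 2)) → k}
    (h : F.linearPart Λ (i + 1) v = 0) : v = 0 := by
  let z : Fin (F.rank (i + 2)) → A := fun a => algebraMap k A (v a)
  obtain ⟨w, hw⟩ := exists_eq_l_smul Λ (fst_d_apply Λ F (i + 1) z) (fun b => by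
    rw [snd_d_apply]
    simp [z, h])
  have hdw : F.d i w = 0 := Λ.eq_zero_of_smul_eq_zero (by rw [← map_smul, ← hw, d_d])
  obtain ⟨u, rfl⟩ := (F.exact_succ i w).1 hdw
  obtain ⟨t, ht⟩ := (F.exact_succ (i + 1) (z - Λ.l • u)).1 (by
    rw [map_sub, hw, map_smul, sub_self])
  funext a
  have := fst_d_apply Λ F (i + 2) t a
  rw [ht] at this
  simpa [z] using this

/-- Entries of `d x` have no constant term, so `m * d x = l * w`. Regularity of `l` makes `w` a
cycle, and exactness makes it a boundary. -/
theorem exists_l_smul_eq_m_smul (i : ℕ) (x : Fin (F.rank (i + 2)) → A) :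
    ∃ u, Λ.l • F.d (i + 1) u = Λ.m • F.d (i + 1) x := by
  choose w hw using fun b => Λ.exists_m_mul_eq (fst_d_apply Λ F (i + 1) x b)
  have hw' : Λ.m • F.d (i + 1) x = Λ.l • w := funext hw
  have hdw : F.d i w = 0 := Λ.eq_zero_of_smul_eq_zero (by
    rw [← map_smul, ← hw', map_smul, d_d, smul_zero])
  obtain ⟨u, rfl⟩ := (F.exact_succ i w).1 hdw
  exact ⟨u, hw'.symm⟩

theorem exists_isHomog_l_smul_eq_m_smul (i : ℕ) {N : ℤ} {x : Fin (F.rank (i + 2)) → A}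
    (hx : F.IsHomog (i + 2) N x) :
    ∃ u, F.IsHomog (i + 2) N u ∧ Λ.l • F.d (i + 1) u = Λ.m • F.d (i + 1) x := by
  obtain ⟨u, hu⟩ := F.exists_l_smul_eq_m_smul Λ i x
  refine ⟨_, F.component_isHomog _ _ u, ?_⟩
  have hcomp : ∀ j (y : Fin (F.rank j) → A),
      F.component j (1 + N) (Λ.l • y) = Λ.l • F.component j N y := by
    intro j y
    funext a
    rw [component, add_sub_assoc]
    exact DirectSum.coe_decompose_mul_add_of_left_mem 𝒜 Λ.l_mem
  have hmx : F.IsHomog (i + 2) (1 + N) (Λ.m • x) := fun a => by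
    rw [add_sub_assoc]
    exact SetLike.mul_mem_graded Λ.m_mem (hx a)
  rw [← map_smul, ← map_smul] at hu
  rw [← map_smul, ← hcomp, d_component, hu, ← d_component, F.component_of_isHomog hmx, map_smul]

/-- For constants `z` with entries `v`, the element `m * z - l * u` is a cycle for a suitable `u`,
hence `d t` for some `t`. Its coefficient of `m` modulo `l` is `v`, and also the linear part applied
to the constant terms of `t`. -/
theorem linearPart_surjective (i : ℕ) : Function.Surjective (F.linearPart Λ (i + 2)) := by
  intro v
  let z : Fin (F.rank (i + 2)) → A := fun a => algebraMap k A (v a)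
  obtain ⟨u, hu⟩ := F.exists_l_smul_eq_m_smul Λ i z
  obtain ⟨t, ht⟩ := (F.exact_succ (i + 1) (Λ.m • z - Λ.l • u)).1 (by
    rw [map_sub, map_smul, map_smul, hu, sub_self])
  refine ⟨fun a => Λ.fst (t a), funext fun b => ?_⟩
  rw [← snd_d_apply, ht]
  rw [Pi.sub_apply, Pi.smul_apply, Pi.smul_apply, smul_eq_mul, smul_eq_mul, map_sub, Λ.snd_l_mul,
    Λ.snd_mul, Λ.fst_m, Λ.snd_m, Λ.fst_algebraMap]
  ring

theorem linearPart_coeff_eq_zero (i : ℕ) {a : Fin (F.rank (i + 1))} {b : Fin (F.rank i)}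
    (h : F.deg (i + 1) a ≠ F.deg i b + 1) : Λ.snd (F.d i (Pi.single a 1) b) = 0 :=
  Λ.snd_of_mem (by omega) (F.d_mem i a b)

/-- The linear part joins only basis vectors whose degrees differ by one, so it is block diagonal by
degree and each block is injective. -/
theorem diagram_succ_le (Λ : LinearParameter k 𝒜) (i : ℕ) (j : ℤ) : F.diagram (i + 2) (j + 1) ≤ F.diagram (i + 1) j := by
  rw [diagram_apply, diagram_apply, Nat.cast_le]
  refine card_filter_le_of_injective (F.linearPart Λ (i + 1)) (fun v hv b hb => ?_)
    fun v => F.linearPart_injective Λ i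
  rw [linearPart_apply]
  refine Finset.sum_eq_zero fun a _ => ?_
  by_cases ha : F.deg (i + 2) a = j + 1
  · rw [F.linearPart_coeff_eq_zero Λ _ fun h => hb (by linarith [ha.symm.trans h]), zero_mul]
  · rw [hv a ha, mul_zero]

theorem diagram_le_succ (Λ : LinearParameter k 𝒜) (i : ℕ) (j : ℤ) : F.diagram (i + 2) j ≤ F.diagram (i + 3) (j + 1) := by
  rw [diagram_apply, diagram_apply, Nat.cast_le]
  refine card_filter_le_of_surjective (F.linearPart Λ (i + 2)) (fun v hv b hb => ?_)
    (F.linearPart_surjective Λ i)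
  rw [linearPart_apply]
  refine Finset.sum_eq_zero fun a _ => ?_
  by_cases ha : F.deg (i + 3) a = j + 1
  · rw [hv a ha, mul_zero]
  · rw [F.linearPart_coeff_eq_zero Λ _ fun h => ha (h.trans (by rw [hb])), zero_mul]

end LinearParameter

end MinimalGradedFreeResolution

/-! ### Dimension count in a single degree -/

namespace MinimalGradedFreeResolution

variable {k A : Type u} [Field k] [CommRing A] [Algebra k A] {𝒜 : ℤ → AddSubgroup A}
  (Λ : LinearParameter k 𝒜)
  {M : Type v} [AddCommGroup M] [Module A M] {ℳ : ℤ → AddSubgroup M}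
  (F : MinimalGradedFreeResolution 𝒜 ℳ)

/-- The elements of degree `N` of `F i` supported on the basis vectors satisfying `p`, in terms of
the basis `l ^ n`, `l ^ (n - 1) * m` of the forms of degree `n`. -/
def formMap (i : ℕ) (N : ℤ) (p : Fin (F.rank i) → Prop) [DecidablePred p] :
    ({b // p b} × Fin 2 → k) →ₗ[k] (Fin (F.rank i) → A) :=
  LinearMap.pi fun b => if h : p b then
    (LinearMap.proj (⟨b, h⟩, 0)).smulRight (Λ.l ^ (N - F.deg i b).toNat) +
      (LinearMap.proj (⟨b, h⟩, 1)).smulRight (Λ.l ^ (N - F.deg i b - 1).toNat * Λ.m)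
  else 0

variable {F} in
theorem formMap_apply_of_pos {i : ℕ} {N : ℤ} {p : Fin (F.rank i) → Prop} [DecidablePred p]
    (v : {b // p b} × Fin 2 → k) {b : Fin (F.rank i)} (h : p b) :
    F.formMap Λ i N p v b = v (⟨b, h⟩, 0) • Λ.l ^ (N - F.deg i b).toNat +
      v (⟨b, h⟩, 1) • (Λ.l ^ (N - F.deg i b - 1).toNat * Λ.m) := by
  simp [formMap, h]

variable {F} in
theorem formMap_apply_of_neg {i : ℕ} {N : ℤ} {p : Fin (F.rank i) → Prop} [DecidablePred p]
    (v : {b // p b} × Fin 2 → k) {b : Fin (F.rank i)} (h : ¬ p b) :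
    F.formMap Λ i N p v b = 0 := by
  simp [formMap, h]

variable {F} in
theorem formMap_injective {i : ℕ} {N : ℤ} {p : Fin (F.rank i) → Prop} [DecidablePred p]
    (hp : ∀ b, p b → F.deg i b < N) : Function.Injective (F.formMap Λ i N p) := by
  rw [injective_iff_map_eq_zero]
  intro v hv
  funext ⟨⟨b, hb⟩, j⟩
  have h := congrFun hv b
  rw [formMap_apply_of_pos Λ v hb] at h
  have h' := Λ.indep_pow (sub_pos.2 (hp b hb)) h
  fin_cases j
  · exact h'.1
  · exact h'.2

variable {F} in
theorem mem_range_formMap {i : ℕ} {N : ℤ} {p : Fin (F.rank i) → Prop} [DecidablePred p]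
    (hp : ∀ b, p b → F.deg i b < N) {w : Fin (F.rank i) → A} (hw : F.IsHomog i N w)
    (hw0 : ∀ b, ¬ p b → w b = 0) : w ∈ LinearMap.range (F.formMap Λ i N p) := by
  choose c c' hc using fun b : {b // p b} => Λ.of_toNat (sub_pos.2 (hp b b.2)) (hw b)
  refine ⟨fun x => if x.2 = 0 then c x.1 else c' x.1, funext fun b => ?_⟩
  by_cases hb : p b
  · rw [formMap_apply_of_pos Λ _ hb, hc ⟨b, hb⟩]
    simp
  · rw [formMap_apply_of_neg Λ _ hb, hw0 b hb]

variable {F} in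
theorem formMap_isHomog [GradedRing 𝒜] {i : ℕ} {N : ℤ} {p : Fin (F.rank i) → Prop}
    [DecidablePred p] (hp : ∀ b, p b → F.deg i b < N) (v : {b // p b} × Fin 2 → k) :
    F.IsHomog i N (F.formMap Λ i N p v) := by
  intro b
  by_cases hb : p b
  · have h := hp b hb
    rw [formMap_apply_of_pos Λ _ hb]
    refine add_mem (Λ.smul_mem _ ?_) (Λ.smul_mem _ ?_)
    · have := Λ.pow_mem (N - F.deg i b).toNat
      rwa [Int.toNat_of_nonneg (by omega)] at this
    · have := SetLike.mul_mem_graded (Λ.pow_mem (N - F.deg i b - 1).toNat) Λ.m_mem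
      rwa [Int.toNat_of_nonneg (by omega), sub_add_cancel] at this
  · rw [formMap_apply_of_neg Λ _ hb]
    exact zero_mem _

/-- The elements of degree `N` of the image of a differential that are powers of `l` times images
of basis vectors. -/
def imageFamily (i : ℕ) (N : ℤ) (c : {c : Fin (F.rank (i + 1)) // F.deg (i + 1) c ≤ N}) :
    Fin (F.rank i) → A :=
  Λ.l ^ (N - F.deg (i + 1) c).toNat • F.d i (Pi.single c.1 1)

theorem l_pow_smul_mem_span_imageFamily {i : ℕ} {N : ℤ} (n : ℕ) {w : Fin (F.rank i) → A}
    (hw : w ∈ Submodule.span k (Set.range (F.imageFamily Λ i N))) :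
    Λ.l ^ n • w ∈ Submodule.span k (Set.range (F.imageFamily Λ i (N + n))) := by
  induction hw using Submodule.span_induction with
  | mem w hw =>
    obtain ⟨⟨c, hc⟩, rfl⟩ := hw
    refine Submodule.subset_span ⟨⟨c, by omega⟩, ?_⟩
    simp only [imageFamily]
    rw [smul_smul, ← pow_add]
    congr 2
    omega
  | zero =>
    rw [smul_zero]
    exact zero_mem _
  | add w w' _ _ h h' =>
    rw [smul_add]
    exact add_mem h h'
  | smul c w _ h =>
    rw [smul_comm]
    exact Submodule.smul_mem _ _ h

/-- Forms of positive degree are spanned by `l ^ n` and `l ^ (n - 1) * m`. The second kind is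
removed by trading `m * d e_c` for `l * d u`, where `u` has the same degree as `e_c`. That degree is
below `N`, so induction applies; it stops below the least degree of a basis vector. -/
theorem d_mem_span_imageFamily [GradedRing 𝒜] (i : ℕ) {N : ℤ} {z : Fin (F.rank (i + 2)) → A}
    (hz : F.IsHomog (i + 2) N z) :
    F.d (i + 1) z ∈ Submodule.span k (Set.range (F.imageFamily Λ (i + 1) N)) := by
  obtain ⟨B, hB⟩ : ∃ B : ℤ, ∀ c, B ≤ F.deg (i + 2) c := by
    obtain ⟨B, hB⟩ := (Set.finite_range (F.deg (i + 2))).bddBelow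
    exact ⟨B, fun c => hB ⟨c, rfl⟩⟩
  obtain ⟨n, hn⟩ : ∃ n : ℕ, N < B + n := ⟨(N - B + 1).toNat, by omega⟩
  induction n generalizing N z with
  | zero =>
    have : z = 0 := funext fun c => Λ.of_neg _ (by have := hB c; omega) _ (hz c)
    rw [this, map_zero]
    exact zero_mem _
  | succ n ih =>
    rw [pi_eq_sum_univ' z, map_sum]
    refine Submodule.sum_mem _ fun c _ => ?_
    rw [map_smul]
    have hc := hz c
    rcases lt_trichotomy N (F.deg (i + 2) c) with h | h | h
    · rw [Λ.of_neg _ (by omega) _ hc, zero_smul]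
      exact zero_mem _
    · rw [h, sub_self] at hc
      obtain ⟨r, hr⟩ := Λ.of_zero _ hc
      rw [hr, algebraMap_smul]
      refine Submodule.smul_mem _ _ (Submodule.subset_span ⟨⟨c, h.ge⟩, ?_⟩)
      simp only [imageFamily]
      rw [h, sub_self, Int.toNat_zero, pow_zero, one_smul]
    · obtain ⟨r, r', hr⟩ := Λ.of_toNat (sub_pos.2 h) hc
      rw [hr, add_smul, smul_assoc, smul_assoc]
      refine add_mem (Submodule.smul_mem _ _ (Submodule.subset_span ⟨⟨c, h.le⟩, rfl⟩))
        (Submodule.smul_mem _ _ ?_)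
      obtain ⟨u, hu, hul⟩ := F.exists_isHomog_l_smul_eq_m_smul Λ i (F.isHomog_single (i + 2) c)
      have h1 := F.l_pow_smul_mem_span_imageFamily Λ (N - F.deg (i + 2) c).toNat
        (ih hu (by push_cast at hn; omega))
      rw [Int.toNat_of_nonneg (by omega), add_sub_cancel] at h1
      rw [mul_smul, ← hul, smul_smul, ← pow_succ]
      convert h1 using 3
      omega

/-- Apply `d 0` in degree `N + 2` to the span of the basis vectors of `F 1` of degree at most `N +
1`; this source has dimension twice their number. The first summand on the right bounds the image,
the second the kernel, and rank-nullity concludes. -/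
theorem two_mul_card_le [GradedRing 𝒜] (Λ : LinearParameter k 𝒜) (N : ℤ) :
    2 * (Finset.univ.filter fun a => F.deg 1 a ≤ N + 1).card ≤
      2 * (Finset.univ.filter fun b => F.deg 0 b ≤ N).card +
        (Finset.univ.filter fun c => F.deg 2 c ≤ N + 2).card := by
  rw [← Fintype.card_subtype, ← Fintype.card_subtype, ← Fintype.card_subtype]
  have hp1 : ∀ a, F.deg 1 a ≤ N + 1 → F.deg 1 a < N + 2 := by intros; omega
  have hp0 : ∀ b, F.deg 0 b ≤ N → F.deg 0 b < N + 2 := by intros; omega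
  set Φ := F.formMap Λ 1 (N + 2) fun a => F.deg 1 a ≤ N + 1 with hΦ
  set Ψ := F.formMap Λ 0 (N + 2) fun b => F.deg 0 b ≤ N
  set D : _ →ₗ[k] (Fin (F.rank 0) → A) := (F.d 0).restrictScalars k ∘ₗ Φ
  have hrange : LinearMap.range D ≤ LinearMap.range Ψ := by
    rintro _ ⟨v, rfl⟩
    refine mem_range_formMap Λ hp0 (F.d_isHomog (formMap_isHomog Λ hp1 v)) fun b hb => ?_
    change F.d 0 (Φ v) b = 0
    rw [d_apply]
    refine Finset.sum_eq_zero fun a _ => ?_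
    by_cases ha : F.deg 1 a ≤ N + 1
    -- Here `b` has degree at least `N + 1`, hence at least that of `a`, so minimality kills the
    -- entry.
    · rw [F.d_single_eq_zero Λ 0 (le_trans ha (by omega)), mul_zero]
    · rw [hΦ, formMap_apply_of_neg Λ _ ha, zero_mul]
  have h0 : Module.finrank k (LinearMap.range D) ≤ 2 * Fintype.card {b // F.deg 0 b ≤ N} := by
    refine (Submodule.finrank_mono hrange).trans ((LinearMap.finrank_range_le Ψ).trans ?_)
    rw [Module.finrank_fintype_fun_eq_card, Fintype.card_prod, Fintype.card_fin, mul_comm]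
  have hker : (LinearMap.ker D).map Φ ≤
      Submodule.span k (Set.range (F.imageFamily Λ 1 (N + 2))) := by
    rintro _ ⟨v, hv, rfl⟩
    obtain ⟨z, hz, hzw⟩ := F.exists_isHomog_preimage (formMap_isHomog Λ hp1 v) hv
    rw [hΦ, ← hzw]
    exact F.d_mem_span_imageFamily Λ 0 hz
  have h2 : Module.finrank k (LinearMap.ker D) ≤ Fintype.card {c // F.deg 2 c ≤ N + 2} := by
    rw [(Submodule.equivMapOfInjective Φ (formMap_injective Λ hp1) _).finrank_eq]
    have := FiniteDimensional.span_of_finite k (Set.finite_range (F.imageFamily Λ 1 (N + 2)))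
    exact (Submodule.finrank_mono hker).trans (finrank_range_le_card _)
  have h3 := LinearMap.finrank_range_add_finrank_ker D
  rw [Module.finrank_fintype_fun_eq_card, Fintype.card_prod, Fintype.card_fin] at h3
  omega

end MinimalGradedFreeResolution

/-! ### Betti diagrams satisfy the inequalities -/

/-- The sum of the entries in the rows up to `n`. -/
def cumulative (n : ℤ) : (ℤ →₀ ℚ) →ₗ[ℚ] ℚ :=
  Finsupp.linearCombination ℚ fun j => if j ≤ n then 1 else 0

theorem cumulative_single (n j : ℤ) (c : ℚ) :
    cumulative n (Finsupp.single j c) = if j ≤ n then c else 0 := by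
  simp [cumulative]

theorem finsum_shift (f : ℤ →₀ ℚ) (n c : ℤ) :
    ∑ᶠ j ∈ Set.Iic n, f (j + c) = cumulative (n + c) f := by
  have h1 : ∀ j : ℤ, (∑ᶠ (_ : j ∈ Set.Iic n), f (j + c)) =
      (fun x => if x ≤ n + c then f x else 0) (Equiv.addRight c j) := by
    intro j
    rw [finsum_eq_if]
    simp
  rw [finsum_congr h1, finsum_comp_equiv (f := fun x => if x ≤ n + c then f x else 0),
    finsum_eq_sum_of_support_subset (s := f.support)]
  · rw [cumulative, Finsupp.linearCombination_apply, Finsupp.sum]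
    simp
  · intro x hx
    by_contra h
    simp at h
    simp [h] at hx

theorem finite_shift (f : ℤ →₀ ℚ) (s : Set ℤ) (r : ℚ) (e : ℤ) :
    (s ∩ Function.support fun j : ℤ => r * f (j + e)).Finite := by
  refine (f.hasFiniteSupport.preimage ((add_left_injective e).injOn)).subset ?_
  rintro j ⟨-, hj⟩
  exact right_ne_zero_of_mul hj

theorem gamma_apply (n : ℤ) (v : Diagram) :
    gamma n v = 2 * cumulative n (v 0) - 2 * cumulative (n + 1) (v 1) +
      cumulative (n + 2) (v 2) := by
  have h : ∀ j, gammaTerm j v = 2 * v 0 (j + 0) + (-2 * v 1 (j + 1) + 1 * v 2 (j + 2)) := by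
    intro j
    simp only [gammaTerm, epsilon, LinearMap.add_apply, LinearMap.sub_apply, LinearMap.smul_apply,
      LinearMap.comp_apply, LinearMap.proj_apply, Finsupp.lapply_apply, smul_eq_mul, add_zero]
    ring
  have hfin := fun (i : ℕ) (r : ℚ) (e : ℤ) => finite_shift (v i) (Set.Iic n) r e
  change ∑ᶠ j ∈ Set.Iic n, gammaTerm j v = _
  simp only [h]
  rw [finsum_mem_add_distrib' (hfin 0 2 0) (((hfin 1 (-2) 1).union (hfin 2 1 2)).subset ?_),
    finsum_mem_add_distrib' (hfin 1 (-2) 1) (hfin 2 1 2), ← mul_finsum_mem, ← mul_finsum_mem,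
    ← mul_finsum_mem, finsum_shift, finsum_shift, finsum_shift, add_zero]
  · ring
  · rw [← Set.inter_union_distrib_left]
    exact Set.inter_subset_inter_right _ (Function.support_add _ _)

theorem cumulative_diagram {A : Type u} [CommRing A] {𝒜 : ℤ → AddSubgroup A}
    {M : Type v} [AddCommGroup M] [Module A M] {ℳ : ℤ → AddSubgroup M}
    (F : MinimalGradedFreeResolution 𝒜 ℳ) (n : ℤ) (i : ℕ) :
    cumulative n (F.diagram i) = (Finset.univ.filter fun a => F.deg i a ≤ n).card := by
  simp [MinimalGradedFreeResolution.diagram, map_sum, cumulative_single]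

theorem mem_facetCone_of_isBettiDiagram {k A : Type u} [Field k] [CommRing A] [Algebra k A]
    {𝒜 : ℤ → AddSubgroup A} [GradedRing 𝒜] (Λ : LinearParameter k 𝒜) {v : Diagram}
    (hv : IsBettiDiagram 𝒜 v) : v ∈ facetCone := by
  obtain ⟨M, _, _, ℳ, -, -, -, F, rfl⟩ := hv
  have hnn : ∀ i j, 0 ≤ F.diagram i j := fun i j => by
    rw [F.diagram_apply]
    exact Nat.cast_nonneg _
  refine ⟨fun i _ j => hnn i j, fun n => ?_, fun n => ?_, fun i hi j => ?_⟩
  · exact sub_nonneg.2 (F.diagram_succ_le Λ 0 n)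
  · rw [gamma_apply, cumulative_diagram, cumulative_diagram, cumulative_diagram]
    have h := F.two_mul_card_le Λ n
    have h' : (2 * (Finset.univ.filter fun a => F.deg 1 a ≤ n + 1).card : ℚ) ≤
      2 * (Finset.univ.filter fun b => F.deg 0 b ≤ n).card +
        (Finset.univ.filter fun c => F.deg 2 c ≤ n + 2).card := by exact_mod_cast h
    linarith
  · obtain ⟨i, rfl⟩ : ∃ i', i = i' + 2 := ⟨i - 2, by omega⟩
    have h1 := F.diagram_succ_le Λ (i + 1) j
    have h2 := F.diagram_le_succ Λ i j
    simp only [LinearMap.neg_apply, LinearMap.sub_apply, epsilon, LinearMap.comp_apply,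
      LinearMap.proj_apply, Finsupp.lapply_apply]
    constructor
    · exact sub_nonneg.2 h1
    · rw [neg_sub]
      exact sub_nonneg.2 h2

/-! ### Cones -/

theorem smul_mem_of_nonneg (C : PointedCone ℚ Diagram) {c : ℚ} (hc : 0 ≤ c) {v : Diagram}
    (hv : v ∈ C) : c • v ∈ C :=
  C.smul_mem hc hv

/-- `facetCone` as a pointed cone. -/
def facetPointedCone : PointedCone ℚ Diagram where
  carrier := facetCone
  zero_mem' := by simp [facetCone]
  add_mem' := by
    rintro v w ⟨h1, h2, h3, h4⟩ ⟨h1', h2', h3', h4'⟩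
    refine ⟨fun i hi j => ?_, fun n => ?_, fun n => ?_, fun i hi j => ⟨?_, ?_⟩⟩ <;> rw [map_add]
    · exact add_nonneg (h1 i hi j) (h1' i hi j)
    · exact add_nonneg (h2 n) (h2' n)
    · exact add_nonneg (h3 n) (h3' n)
    · exact add_nonneg (h4 i hi j).1 (h4' i hi j).1
    · exact add_nonneg (h4 i hi j).2 (h4' i hi j).2
  smul_mem' := by
    rintro ⟨c, hc⟩ v ⟨h1, h2, h3, h4⟩
    change c • v ∈ facetCone
    refine ⟨fun i hi j => ?_, fun n => ?_, fun n => ?_, fun i hi j => ⟨?_, ?_⟩⟩ <;> rw [map_smul]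
    · exact mul_nonneg hc (h1 i hi j)
    · exact mul_nonneg hc (h2 n)
    · exact mul_nonneg hc (h3 n)
    · exact mul_nonneg hc (h4 i hi j).1
    · exact mul_nonneg hc (h4 i hi j).2

theorem bettiCone_le_facetPointedCone {k A : Type u} [Field k] [CommRing A] [Algebra k A]
    {𝒜 : ℤ → AddSubgroup A} [GradedRing 𝒜] (Λ : LinearParameter k 𝒜) :
    bettiCone 𝒜 ≤ facetPointedCone :=
  Submodule.span_le.2 fun _ hv => mem_facetCone_of_isBettiDiagram Λ hv

/-! ### Decomposition into pure diagrams -/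

theorem cumulative_apply (n : ℤ) (f : ℤ →₀ ℚ) :
    cumulative n f = ∑ j ∈ f.support, if j ≤ n then f j else 0 := by
  simp [cumulative, Finsupp.linearCombination_apply, Finsupp.sum]

theorem cumulative_nonneg {f : ℤ →₀ ℚ} (hf : ∀ j, 0 ≤ f j) (n : ℤ) : 0 ≤ cumulative n f := by
  rw [cumulative_apply]
  exact Finset.sum_nonneg fun j _ => by split_ifs <;> simp [hf j]

theorem cumulative_eq_zero {f : ℤ →₀ ℚ} {n : ℤ} (hf : ∀ j ≤ n, f j = 0) :
    cumulative n f = 0 := by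
  rw [cumulative_apply]
  exact Finset.sum_eq_zero fun j _ => by split_ifs with h <;> simp [hf j, h]

theorem cumulative_pos {f : ℤ →₀ ℚ} (hf : ∀ j, 0 ≤ f j) {n j : ℤ} (hj : j ≤ n) (h : f j ≠ 0) :
    0 < cumulative n f := by
  rw [cumulative_apply]
  refine Finset.sum_pos' (fun j _ => by split_ifs <;> simp [hf j])
    ⟨j, Finsupp.mem_support_iff.2 h, ?_⟩
  rw [if_pos hj]
  exact (hf j).lt_of_ne' h

theorem sub_single_nonneg {f : ℤ →₀ ℚ} (hf : ∀ j, 0 ≤ f j) {a : ℤ} {c : ℚ} (hc : c ≤ f a)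
    (j : ℤ) : 0 ≤ (f - Finsupp.single a c) j := by
  rw [Finsupp.sub_apply, Finsupp.single_apply]
  split_ifs with h
  · subst h
    exact sub_nonneg.2 hc
  · simpa using hf j

theorem support_sub_single_subset {f : ℤ →₀ ℚ} {a : ℤ} (ha : f a ≠ 0) (c : ℚ) :
    (f - Finsupp.single a c).support ⊆ f.support := by
  intro j hj
  rw [Finsupp.mem_support_iff] at hj ⊢
  rintro h
  rw [Finsupp.sub_apply, Finsupp.single_apply] at hj
  split_ifs at hj with h'
  · exact ha (h' ▸ h)
  · simp [h] at hj

theorem card_support_sub_single_le {f : ℤ →₀ ℚ} {a : ℤ} (ha : f a ≠ 0) (c : ℚ) :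
    (f - Finsupp.single a c).support.card ≤ f.support.card :=
  Finset.card_le_card (support_sub_single_subset ha c)

theorem card_support_sub_single_lt {f : ℤ →₀ ℚ} {a : ℤ} (ha : f a ≠ 0) :
    (f - Finsupp.single a (f a)).support.card < f.support.card := by
  refine Finset.card_lt_card ((Finset.ssubset_iff_of_subset (support_sub_single_subset ha _)).2
    ⟨a, Finsupp.mem_support_iff.2 ha, ?_⟩)
  simp

/-- The condition that the supply `p` dominates the demand `h`, where supply in row `i` can serve
demand in the rows `j > i`. -/
def Dominates (p h : ℤ →₀ ℚ) : Prop := ∀ n, cumulative (n + 1) h ≤ cumulative n p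

/-- Because `b` is at or below the lowest row with demand, sums stopping before `b` have no demand
to serve. From `b` on, both sides lose the same amount `c`, since `a < b`. -/
theorem Dominates.sub_single {p h : ℤ →₀ ℚ} (H : Dominates p h) (hp : ∀ j, 0 ≤ p j) {a b : ℤ}
    (hab : a < b) {c : ℚ} (hc : c ≤ p a) (hb : ∀ j < b, h j = 0) :
    Dominates (p - Finsupp.single a c) (h - Finsupp.single b c) := by
  intro n
  by_cases hn : n + 1 < b
  · refine le_trans (le_of_eq (cumulative_eq_zero fun j hj => ?_))
      (cumulative_nonneg (sub_single_nonneg hp hc) n)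
    rw [Finsupp.sub_apply, hb j (by omega), Finsupp.single_apply, if_neg (by omega), sub_zero]
  · rw [map_sub, map_sub, cumulative_single, cumulative_single, if_pos (by omega),
      if_pos (by omega)]
    exact sub_le_sub_right (H n) c

theorem Dominates.exists_supply {p h : ℤ →₀ ℚ} (H : Dominates p h) (hp : ∀ j, 0 ≤ p j)
    (hh : ∀ j, 0 ≤ h j) {b : ℤ} (hb : h b ≠ 0) : ∃ a < b, 0 < p a := by
  by_contra! hc
  have h1 := H (b - 1)
  rw [sub_add_cancel, cumulative_eq_zero fun j hj => le_antisymm (hc j (by omega)) (hp j)] at h1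
  exact absurd (cumulative_pos hh le_rfl hb) (not_lt.2 h1)

/-- Translation of the rows. -/
def shift (e : ℤ) : (ℤ →₀ ℚ) →ₗ[ℚ] (ℤ →₀ ℚ) := Finsupp.lmapDomain ℚ ℚ (· + e)

theorem shift_apply (e : ℤ) (f : ℤ →₀ ℚ) (j : ℤ) : shift e f j = f (j - e) := by
  conv_lhs => rw [← sub_add_cancel j e]
  exact Finsupp.mapDomain_apply (add_left_injective e) f (j - e)

theorem shift_single (e j : ℤ) (c : ℚ) :
    shift e (Finsupp.single j c) = Finsupp.single (j + e) c :=
  Finsupp.mapDomain_single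

theorem cumulative_shift (n e : ℤ) (f : ℤ →₀ ℚ) :
    cumulative n (shift e f) = cumulative (n - e) f := by
  rw [cumulative, shift, Finsupp.lmapDomain_apply, Finsupp.linearCombination_mapDomain, cumulative]
  congr 2
  funext j
  simp only [Function.comp_apply, le_sub_iff_add_le]

/-- The diagram with column `p`, column `f + t`, and then the translates of `t`. -/
def assemble : (ℤ →₀ ℚ) × (ℤ →₀ ℚ) × (ℤ →₀ ℚ) →ₗ[ℚ] Diagram :=
  LinearMap.pi fun
    | 0 => LinearMap.fst _ _ _
    | 1 => (LinearMap.fst _ _ _ + LinearMap.snd _ _ _) ∘ₗ LinearMap.snd _ _ _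
    | i + 2 => shift (i + 1) ∘ₗ LinearMap.snd _ _ _ ∘ₗ LinearMap.snd _ _ _

theorem pureDiagram_free (a : ℤ) :
    pureDiagram (.free a) = assemble (Finsupp.single a 1, 0, 0) := by
  funext i
  rcases i with _ | _ | i <;> simp [pureDiagram, assemble]

theorem pureDiagram_finite (a b : ℤ) (h : a < b) :
    pureDiagram (.finite a b h) = assemble (Finsupp.single a 1, Finsupp.single b 1, 0) := by
  funext i
  rcases i with _ | _ | i <;> simp [pureDiagram, assemble]

theorem pureDiagram_infinite (a b : ℤ) (h : a < b) :
    pureDiagram (.infinite a b h) = assemble (Finsupp.single a 1, 0, Finsupp.single b 2) := by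
  funext i
  rcases i with _ | _ | i <;> simp [pureDiagram, assemble, shift_single]

theorem pureDiagram_mem_pureCone (d : DegreeSequence) : pureDiagram d ∈ pureCone :=
  Submodule.subset_span ⟨d, rfl⟩

theorem assemble_mem_pureCone_of_eq_zero {p : ℤ →₀ ℚ} (hp : ∀ j, 0 ≤ p j) :
    assemble (p, 0, 0) ∈ pureCone := by
  have h : assemble (p, 0, 0) = ∑ j ∈ p.support, p j • pureDiagram (.free j) := by
    simp only [pureDiagram_free, ← map_smul, ← map_sum]
    congr 1
    conv_lhs => rw [← p.sum_single, Finsupp.sum]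
    simp [Prod.ext_iff, Prod.fst_sum, Prod.snd_sum]
  rw [h]
  exact Submodule.sum_mem _ fun j _ => smul_mem_of_nonneg _ (hp j) (pureDiagram_mem_pureCone _)

/-- Greedy transport: serve the lowest row `b` with demand from any row `a < b` with supply,
subtracting as large a multiple of a pure diagram as the entries allow. Each step empties an entry
and creates none, so the supports shrink. The weight `2⁻¹` appears because an infinite pure diagram
uses one unit of `p` for two units of `t`. -/
theorem assemble_mem_pureCone (p f t : ℤ →₀ ℚ) (hp : ∀ j, 0 ≤ p j) (hf : ∀ j, 0 ≤ f j)
    (ht : ∀ j, 0 ≤ t j) (H : Dominates p (f + (2⁻¹ : ℚ) • t)) :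
    assemble (p, f, t) ∈ pureCone := by
  induction hn : p.support.card + f.support.card + t.support.card using Nat.strong_induction_on
    generalizing p f t with
  | _ n ih =>
  subst hn
  rcases (f.support ∪ t.support).eq_empty_or_nonempty with he | hne
  · rw [Finset.union_eq_empty, Finsupp.support_eq_empty, Finsupp.support_eq_empty] at he
    rw [he.1, he.2]
    exact assemble_mem_pureCone_of_eq_zero hp
  have hh : ∀ j, 0 ≤ (f + (2⁻¹ : ℚ) • t) j := fun j =>
    add_nonneg (hf j) (mul_nonneg (by norm_num) (ht j))
  set b := (f.support ∪ t.support).min' hne with hbdef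
  have hlow : ∀ j < b, f j = 0 ∧ t j = 0 := by
    intro j hj
    have h1 : j ∉ f.support ∪ t.support := fun h => absurd (Finset.min'_le _ j h) (not_le.2 hj)
    simpa using h1
  have hlow' : ∀ j < b, (f + (2⁻¹ : ℚ) • t) j = 0 := by
    intro j hj
    simp [hlow j hj]
  have hbmem : f b ≠ 0 ∨ t b ≠ 0 := by
    have := Finset.min'_mem _ hne
    rwa [← hbdef, Finset.mem_union, Finsupp.mem_support_iff, Finsupp.mem_support_iff] at this
  have hhb : (f + (2⁻¹ : ℚ) • t) b ≠ 0 := by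
    have h1 := hf b
    have h2 := ht b
    simp only [Finsupp.add_apply, Finsupp.smul_apply, smul_eq_mul]
    rcases hbmem with h | h
    · have := h1.lt_of_ne' h
      positivity
    · have := h2.lt_of_ne' h
      positivity
  obtain ⟨a, hab, ha⟩ := H.exists_supply hp hh hhb
  by_cases hfb : f b = 0
  · have htb := hbmem.resolve_left (not_not.2 hfb)
    have htb' := (ht b).lt_of_ne' htb
    set c := min (p a) (2⁻¹ * t b) with hc
    have hc0 : 0 < c := lt_min ha (by positivity)
    have hca : c ≤ p a := min_le_left _ _
    have hcb : 2 * c ≤ t b := by linarith [min_le_right (p a) (2⁻¹ * t b)]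
    have key := ih _ ?_ (p - Finsupp.single a c) f (t - Finsupp.single b (2 * c))
      (sub_single_nonneg hp hca) hf (sub_single_nonneg ht hcb) ?_ rfl
    · have e : assemble (p, f, t) =
          assemble (p - Finsupp.single a c, f, t - Finsupp.single b (2 * c)) +
            c • pureDiagram (.infinite a b hab) := by
        rw [pureDiagram_infinite, ← map_smul, ← map_add]
        simp [mul_comm c 2]
      rw [e]
      exact add_mem key (smul_mem_of_nonneg _ hc0.le (pureDiagram_mem_pureCone _))
    · have h1 := card_support_sub_single_le ha.ne' c
      have h2 := card_support_sub_single_le htb (2 * c)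
      rcases min_choice (p a) (2⁻¹ * t b) with h | h
      · have h3 := card_support_sub_single_lt ha.ne'
        rw [← h, ← hc] at h3
        omega
      · have h3 := card_support_sub_single_lt htb
        rw [show t b = 2 * c by rw [hc, h]; ring] at h3
        omega
    · convert H.sub_single hp hab hca hlow' using 1
      rw [smul_sub, Finsupp.smul_single, smul_eq_mul, inv_mul_cancel_left₀ two_ne_zero]
      abel
  · have hfb' := (hf b).lt_of_ne' hfb
    set c := min (p a) (f b) with hc
    have hc0 : 0 < c := lt_min ha hfb'
    have hca : c ≤ p a := min_le_left _ _
    have hcb : c ≤ f b := min_le_right _ _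
    have key := ih _ ?_ (p - Finsupp.single a c) (f - Finsupp.single b c) t
      (sub_single_nonneg hp hca) (sub_single_nonneg hf hcb) ht ?_ rfl
    · have e : assemble (p, f, t) =
          assemble (p - Finsupp.single a c, f - Finsupp.single b c, t) +
            c • pureDiagram (.finite a b hab) := by
        rw [pureDiagram_finite, ← map_smul, ← map_add]
        simp
      rw [e]
      exact add_mem key (smul_mem_of_nonneg _ hc0.le (pureDiagram_mem_pureCone _))
    · have h1 := card_support_sub_single_le ha.ne' c
      have h2 := card_support_sub_single_le hfb c
      rcases min_choice (p a) (f b) with h | h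
      · have h3 := card_support_sub_single_lt ha.ne'
        rw [← h, ← hc] at h3
        omega
      · have h3 := card_support_sub_single_lt hfb
        rw [← h, ← hc] at h3
        omega
    · convert H.sub_single hp hab hca hlow' using 1
      abel

/-- The equalities make every column from the second on a translate of column two. Moving that
column back by one row gives `t`; then `α_k ≥ 0` is nonnegativity of the excess `f`, and half of
`γ_k ≥ 0` is the dominance condition. -/
theorem facetCone_subset_pureCone : facetCone ⊆ (pureCone : Set Diagram) := by
  intro v hv
  have hnn : ∀ i j, 0 ≤ v i j := epsilon_nonneg_of_mem_facetCone hv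
  obtain ⟨-, ha, hg, hp⟩ := hv
  have hper : ∀ i j, v (i + 2) j = v 2 (j - i) := by
    intro i
    induction i with
    | zero => simp
    | succ i ih =>
      intro j
      have h1 := hp (i + 2) (by omega) (j - 1)
      simp only [epsilon, LinearMap.neg_apply, LinearMap.sub_apply, LinearMap.comp_apply,
        LinearMap.proj_apply, Finsupp.lapply_apply, sub_add_cancel] at h1
      rw [show i + 1 + 2 = i + 2 + 1 by omega, ← sub_eq_zero.1 (le_antisymm (neg_nonneg.1 h1.2) h1.1),
        ih, Nat.cast_succ]
      congr 1
      ring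
  have e : v = assemble (v 0, v 1 - shift (-1) (v 2), shift (-1) (v 2)) := by
    funext i
    rcases i with _ | _ | i
    · rfl
    · exact (sub_add_cancel (v 1) (shift (-1) (v 2))).symm
    · ext j
      change v (i + 2) j = shift (i + 1) (shift (-1) (v 2)) j
      rw [hper, shift_apply, shift_apply]
      congr 1
      ring
  rw [e]
  refine assemble_mem_pureCone _ _ _ (hnn 0) (fun j => ?_) (fun j => ?_) fun n => ?_
  · rw [Finsupp.sub_apply, shift_apply, sub_neg_eq_add]
    exact ha j
  · rw [shift_apply]
    exact hnn _ _
  · have h := hg n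
    rw [gamma_apply] at h
    rw [map_add, map_sub, map_smul, cumulative_shift, sub_neg_eq_add, add_assoc, smul_eq_mul]
    norm_num
    linarith

/-! ### Modules with pure resolutions -/

section Cyclic

variable {A : Type u} [CommRing A] (𝒜 : ℤ → AddSubgroup A)

/-- The grading of the quotient by an ideal, the class of `1` being of degree `e`. -/
def quotientGrading (I : Ideal A) (e : ℤ) (j : ℤ) : AddSubgroup (A ⧸ I) :=
  (𝒜 (j - e)).map (Ideal.Quotient.mk I).toAddMonoidHom

variable {𝒜}

theorem isBettiDiagram_of_homogeneous [GradedRing 𝒜] {I : Ideal A} (hI : I.IsHomogeneous 𝒜)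
    {e : ℤ} (F : MinimalGradedFreeResolution 𝒜 (quotientGrading 𝒜 I e)) :
    IsBettiDiagram 𝒜 F.diagram := by
  refine ⟨A ⧸ I, inferInstance, inferInstance, quotientGrading 𝒜 I e, inferInstance,
    isInternal_quotient 𝒜 hI e _ fun j x => Iff.rfl, ⟨?_⟩, F, rfl⟩
  rintro i j a _ ha ⟨x, hx, rfl⟩
  refine ⟨a * x, ?_, rfl⟩
  rw [vadd_eq_add, add_sub_assoc]
  exact SetLike.mul_mem_graded ha hx

theorem mem_smul_top_of_forall_mem {I : Ideal A} {r : ℕ} {w : Fin r → A} (h : ∀ b, w b ∈ I) :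
    w ∈ I • (⊤ : Submodule A (Fin r → A)) := by
  rw [pi_eq_sum_univ' w]
  exact Submodule.sum_mem _ fun b _ => Submodule.smul_mem_smul (h b) Submodule.mem_top

theorem range_toLin'_le {I : Ideal A} {r r' : ℕ} {N : Matrix (Fin r) (Fin r') A}
    (h : ∀ b a, N b a ∈ I) : LinearMap.range (Matrix.toLin' N) ≤ I • ⊤ := by
  rintro _ ⟨z, rfl⟩
  refine mem_smul_top_of_forall_mem fun b => ?_
  change ∑ a, N b a * z a ∈ I
  exact Ideal.sum_mem _ fun a _ => Ideal.mul_mem_right _ _ (h b a)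

theorem toLin'_single {r r' : ℕ} (N : Matrix (Fin r) (Fin r') A) (a : Fin r') (b : Fin r) :
    Matrix.toLin' N (Pi.single a 1) b = N b a := by
  simp

theorem mem_irrelevant {j : ℤ} (hj : 0 < j) {x : A} (hx : x ∈ 𝒜 j) : x ∈ irrelevant 𝒜 :=
  Ideal.subset_span ⟨j, hj, hx⟩

/-- The augmentation of a resolution of a cyclic module. -/
def cyclicAug (I : Ideal A) : (Fin 1 → A) →ₗ[A] A ⧸ I := I.mkQ ∘ₗ LinearMap.proj 0

theorem cyclicAug_surjective (I : Ideal A) : Function.Surjective (cyclicAug I) := by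
  intro x
  obtain ⟨a, rfl⟩ := I.mkQ_surjective x
  exact ⟨fun _ => a, rfl⟩

theorem cyclicAug_eq_zero_iff (I : Ideal A) (w : Fin 1 → A) : cyclicAug I w = 0 ↔ w 0 ∈ I :=
  Submodule.Quotient.mk_eq_zero I

theorem cyclicAug_single_mem [GradedRing 𝒜] (I : Ideal A) (e : ℤ) (a : Fin 1) :
    cyclicAug I (Pi.single a 1) ∈ quotientGrading 𝒜 I e e := by
  refine ⟨1, ?_, ?_⟩
  · rw [sub_self]
    exact SetLike.GradedOne.one_mem
  · rw [Subsingleton.elim a 0]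
    simp [cyclicAug]

theorem exact_toLin'_cyclicAug {r : ℕ} (g : Fin r → A) :
    Function.Exact (Matrix.toLin' (Matrix.of fun (_ : Fin 1) a => g a))
      (cyclicAug (Ideal.span (Set.range g))) := by
  intro w
  rw [cyclicAug_eq_zero_iff, Ideal.mem_span_range_iff_exists_fun]
  constructor
  · rintro ⟨c, hc⟩
    refine ⟨c, funext fun b => ?_⟩
    rw [Subsingleton.elim b 0, ← hc]
    change ∑ a, g a * c a = ∑ a, c a * g a
    exact Finset.sum_congr rfl fun a _ => mul_comm (g a) (c a)
  · rintro ⟨c, rfl⟩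
    exact ⟨c, Finset.sum_congr rfl fun a _ => mul_comm (c a) (g a)⟩

theorem isHomogeneous_span_range [GradedRing 𝒜] {r : ℕ} {g : Fin r → A} {n : ℤ}
    (hg : ∀ a, g a ∈ 𝒜 n) : (Ideal.span (Set.range g)).IsHomogeneous 𝒜 := by
  refine Ideal.homogeneous_span _ _ ?_
  rintro _ ⟨a, rfl⟩
  exact ⟨n, hg a⟩

/-- The resolution of a free module of rank one. -/
def freeResolution [GradedRing 𝒜] (e : ℤ) :
    MinimalGradedFreeResolution 𝒜
      (quotientGrading 𝒜 (Ideal.span (Set.range (Fin.elim0 : Fin 0 → A))) e) where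
  rank := fun
    | 0 => 1
    | _ + 1 => 0
  deg := fun _ _ => e
  aug := cyclicAug _
  d := fun
    | 0 => Matrix.toLin' (Matrix.of fun _ a => Fin.elim0 a)
    | _ + 1 => 0
  aug_mem := cyclicAug_single_mem _ e
  d_mem := fun _ a => Fin.elim0 a
  aug_surjective := cyclicAug_surjective _
  exact_zero := exact_toLin'_cyclicAug _
  exact_succ := fun i z => ⟨fun _ => ⟨0, funext fun a => Fin.elim0 a⟩,
    fun _ => by rw [show z = 0 from funext fun a => Fin.elim0 a, map_zero]⟩
  minimal := fun i => by
    rintro _ ⟨z, rfl⟩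
    rw [show z = 0 from funext fun a => Fin.elim0 a, map_zero]
    exact zero_mem _

/-- The resolution of the quotient by a principal ideal generated by a regular element. -/
def principalResolution [GradedRing 𝒜] (e e' : ℤ) (h : e < e') (x : A) (hx : x ∈ 𝒜 (e' - e))
    (hreg : ∀ a, x * a = 0 → a = 0) :
    MinimalGradedFreeResolution 𝒜
      (quotientGrading 𝒜 (Ideal.span (Set.range fun _ : Fin 1 => x)) e) where
  rank := fun
    | 0 => 1
    | 1 => 1
    | _ + 2 => 0
  deg := fun
    | 0 => fun _ => e
    | _ + 1 => fun _ => e'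
  aug := cyclicAug _
  d := fun
    | 0 => Matrix.toLin' (Matrix.of fun _ _ => x)
    | _ + 1 => 0
  aug_mem := cyclicAug_single_mem _ e
  d_mem := fun
    | 0 => fun a b => by
      rw [toLin'_single]
      exact hx
    | _ + 1 => fun a => Fin.elim0 a
  aug_surjective := cyclicAug_surjective _
  exact_zero := exact_toLin'_cyclicAug _
  exact_succ := fun
    | 0 => fun z => by
      constructor
      · intro hz
        have h0 : x * z 0 = 0 := by simpa [Matrix.mulVec, dotProduct] using congrFun hz 0
        refine ⟨0, funext fun a => ?_⟩
        rw [Subsingleton.elim a 0, hreg _ h0]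
        rfl
      · rintro ⟨w, rfl⟩
        exact map_zero _
    | _ + 1 => fun z => ⟨fun _ => ⟨0, funext fun a => Fin.elim0 a⟩, fun _ => rfl⟩
  minimal := fun
    | 0 => range_toLin'_le fun _ _ => mem_irrelevant (sub_pos.2 h) hx
    | _ + 1 => by
      rintro _ ⟨z, rfl⟩
      exact zero_mem _

end Cyclic

/-! ### Periodic resolutions from a matrix factorization, and realization of the pure diagrams. -/

namespace LinearParameter

variable {k A : Type u} [Field k] [CommRing A] [Algebra k A] {𝒜 : ℤ → AddSubgroup A}
  (Λ : LinearParameter k 𝒜)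

/-- The matrix factorization of the relation `m ^ 2 = l * s`. -/
def factorization : Matrix (Fin 2) (Fin 2) A := !![-Λ.m, -Λ.l; Λ.s, Λ.m]

theorem factorization_apply (z : Fin 2 → A) :
    Matrix.toLin' Λ.factorization z =
      ![-(Λ.m * z 0 + Λ.l * z 1), Λ.s * z 0 + Λ.m * z 1] := by
  funext b
  fin_cases b <;> simp [factorization, Matrix.mulVec, dotProduct, Fin.sum_univ_two]
  ring

theorem factorization_mem (b a : Fin 2) : Λ.factorization b a ∈ 𝒜 1 := by
  fin_cases b <;> fin_cases a
  · exact neg_mem Λ.m_mem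
  · exact neg_mem Λ.l_mem
  · exact Λ.s_mem
  · exact Λ.m_mem

variable [GradedRing 𝒜]

/-- The relation read modulo `l` kills the constant term of `z 0`, so `z 0 = c * m + l * b` with `c`
a scalar. Substituting and cancelling `l` determines `z 1`, and the preimage is `(-c, -b)`. -/
theorem mem_range_factorization_iff (z : Fin 2 → A) :
    z ∈ Set.range (Matrix.toLin' Λ.factorization) ↔ Λ.m * z 0 + Λ.l * z 1 = 0 := by
  constructor
  · rintro ⟨w, rfl⟩
    rw [factorization_apply]
    simp only [Matrix.cons_val_zero, Matrix.cons_val_one]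
    linear_combination -w 0 * Λ.mul_self
  · intro h
    have h0 : Λ.fst (z 0) = 0 := by
      have h1 := congrArg Λ.snd h
      rw [map_add, Λ.snd_l_mul, map_zero, add_zero, Λ.snd_mul, Λ.fst_m, Λ.snd_m] at h1
      simpa using h1
    obtain ⟨b, hb⟩ := Λ.spec (z 0)
    rw [h0, map_zero, zero_add, Algebra.smul_def] at hb
    refine ⟨![-algebraMap k A (Λ.snd (z 0)), -b], ?_⟩
    rw [factorization_apply]
    have h1 : z 1 = Λ.s * -algebraMap k A (Λ.snd (z 0)) + Λ.m * -b := by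
      refine sub_eq_zero.1 (Λ.regular _ ?_)
      linear_combination h - Λ.m * hb - algebraMap k A (Λ.snd (z 0)) * Λ.mul_self
    funext i
    fin_cases i
    · simp only [Matrix.cons_val_zero, Matrix.cons_val_one, Fin.zero_eta]
      linear_combination -hb
    · simp only [Matrix.cons_val_zero, Matrix.cons_val_one, Fin.mk_one]
      rw [h1]

/-- The first row of the matrix is the relation up to sign, and the square of the matrix is zero.
Together with the previous description of the range, kernel and image coincide. -/
theorem factorization_apply_eq_zero_iff (z : Fin 2 → A) :
    Matrix.toLin' Λ.factorization z = 0 ↔ Λ.m * z 0 + Λ.l * z 1 = 0 := by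
  constructor
  · intro h
    have := congrFun h 0
    rw [factorization_apply] at this
    exact neg_eq_zero.1 this
  · intro h
    obtain ⟨w, rfl⟩ := (Λ.mem_range_factorization_iff z).2 h
    rw [factorization_apply, factorization_apply]
    funext i
    fin_cases i
    · simp only [Matrix.cons_val_zero, Matrix.cons_val_one, Fin.zero_eta, Pi.zero_apply]
      linear_combination w 0 * Λ.mul_self
    · simp only [Matrix.cons_val_zero, Matrix.cons_val_one, Fin.mk_one, Pi.zero_apply]
      linear_combination w 1 * Λ.mul_self

/-- The generators of a power of the irrelevant ideal, multiplied by a power of `l`. -/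
def powGenerators (n : ℕ) : Fin 2 → A := ![Λ.l ^ n * Λ.m, Λ.l ^ n * Λ.l]

theorem powGenerators_mem (n : ℕ) (a : Fin 2) : Λ.powGenerators n a ∈ 𝒜 (n + 1) := by
  fin_cases a
  · exact SetLike.mul_mem_graded (Λ.pow_mem n) Λ.m_mem
  · exact SetLike.mul_mem_graded (Λ.pow_mem n) Λ.l_mem

/-- The periodic resolution of the quotient by the ideal `l ^ n * (m, l)`. -/
def periodicResolution (e : ℤ) (n : ℕ) :
    MinimalGradedFreeResolution 𝒜
      (quotientGrading 𝒜 (Ideal.span (Set.range (Λ.powGenerators n))) e) where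
  rank := fun
    | 0 => 1
    | _ + 1 => 2
  deg := fun
    | 0 => fun _ => e
    | i + 1 => fun _ => e + (n + 1) + i
  aug := cyclicAug _
  d := fun
    | 0 => Matrix.toLin' (Matrix.of fun _ a => Λ.powGenerators n a)
    | _ + 1 => Matrix.toLin' Λ.factorization
  aug_mem := cyclicAug_single_mem _ e
  d_mem := fun
    | 0 => fun a b => by
      rw [toLin'_single]
      change Λ.powGenerators n a ∈ 𝒜 (e + (n + 1) + ((0 : ℕ) : ℤ) - e)
      rw [Nat.cast_zero, add_zero, add_sub_cancel_left]
      exact Λ.powGenerators_mem n a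
    | i + 1 => fun a b => by
      rw [toLin'_single]
      convert Λ.factorization_mem b a using 2
      push_cast
      ring
  aug_surjective := cyclicAug_surjective _
  exact_zero := exact_toLin'_cyclicAug _
  exact_succ := fun
    | 0 => fun z => by
      rw [Λ.mem_range_factorization_iff]
      have h : ∀ b, Matrix.toLin' (Matrix.of fun (_ : Fin 1) a => Λ.powGenerators n a) z b =
          Λ.l ^ n * (Λ.m * z 0 + Λ.l * z 1) := by
        intro b
        simp [Matrix.mulVec, dotProduct, Fin.sum_univ_two, powGenerators]
        ring
      constructor
      · intro hz
        -- The factor `l ^ n` is regular, so the syzygies of `l ^ n * (m, l)` are those of `(m, l)`.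
        exact Λ.pow_mul_eq_zero n ((h 0).symm.trans (congrFun hz 0))
      · intro hz
        exact funext fun b => (h b).trans (by rw [hz, mul_zero]; rfl)
    | _ + 1 => fun z => by
      rw [Λ.mem_range_factorization_iff]
      exact Λ.factorization_apply_eq_zero_iff z
  minimal := fun
    | 0 => range_toLin'_le fun _ a => mem_irrelevant (by positivity) (Λ.powGenerators_mem n a)
    | _ + 1 => range_toLin'_le fun b a => mem_irrelevant one_pos (Λ.factorization_mem b a)

/-- The witnesses are quotients of the ring, with generator in degree `a`: by zero, by `l ^ (b -
a)`, and by `l ^ n * (m, l)` with `n = b - a - 1`, whose two generators have degree `n + 1`. -/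
theorem isBettiDiagram_pureDiagram (Λ : LinearParameter k 𝒜) (d : DegreeSequence) : IsBettiDiagram 𝒜 (pureDiagram d) := by
  rcases d with a | ⟨a, b, h⟩ | ⟨a, b, h⟩
  · have e : pureDiagram (.free a) = (freeResolution (𝒜 := 𝒜) a).diagram := by
      funext i
      rcases i with _ | i
      · exact (Fin.sum_univ_one fun _ : Fin 1 => Finsupp.single _ (1 : ℚ)).symm
      · exact (Fin.sum_univ_zero (M := ℤ →₀ ℚ) _).symm
    rw [e]
    exact isBettiDiagram_of_homogeneous (isHomogeneous_span_range (n := 0) fun a => Fin.elim0 a) _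
  · have hx : Λ.l ^ (b - a).toNat ∈ 𝒜 (b - a) := by
      have := Λ.pow_mem (b - a).toNat
      rwa [Int.toNat_of_nonneg (by omega)] at this
    have e : pureDiagram (.finite a b h) = (principalResolution a b h _ hx
        fun _ => Λ.pow_mul_eq_zero _).diagram := by
      funext i
      rcases i with _ | _ | i
      · exact (Fin.sum_univ_one fun _ : Fin 1 => Finsupp.single _ (1 : ℚ)).symm
      · exact (Fin.sum_univ_one fun _ : Fin 1 => Finsupp.single _ (1 : ℚ)).symm
      · exact (Fin.sum_univ_zero (M := ℤ →₀ ℚ) _).symm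
    rw [e]
    exact isBettiDiagram_of_homogeneous (isHomogeneous_span_range fun _ => hx) _
  · obtain ⟨n, rfl⟩ : ∃ n : ℕ, b = a + (n + 1) := ⟨(b - a - 1).toNat, by omega⟩
    have e : pureDiagram (.infinite a (a + (n + 1)) h) = (Λ.periodicResolution a n).diagram := by
      funext i
      rcases i with _ | i
      · exact (Fin.sum_univ_one fun _ : Fin 1 => Finsupp.single _ (1 : ℚ)).symm
      · refine Eq.trans ?_ (Fin.sum_univ_two _).symm
        change Finsupp.single (a + (n + 1) + (i : ℤ)) (2 : ℚ) =
          Finsupp.single (a + (n + 1) + (i : ℤ)) 1 + Finsupp.single (a + (n + 1) + (i : ℤ)) 1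
        rw [← Finsupp.single_add]
        norm_num
    rw [e]
    exact isBettiDiagram_of_homogeneous (isHomogeneous_span_range (Λ.powGenerators_mem n)) _

end LinearParameter

end QuadricBetti

end

theorem theorem2p3 {k : Type u} [Field k] (q : MvPolynomial (Fin 2) k)
    (hq : q.IsHomogeneous 2) (hq0 : q ≠ 0) :
    (QuadricBetti.bettiCone (QuadricBetti.quadricGrading q) : Set QuadricBetti.Diagram) =
        (QuadricBetti.pureCone : Set QuadricBetti.Diagram) ∧
      (QuadricBetti.pureCone : Set QuadricBetti.Diagram) = QuadricBetti.facetCone := by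
  let _ := QuadricBetti.quadricGradedRing hq
  obtain ⟨Λ⟩ := QuadricBetti.exists_linearParameter hq hq0
  have h1 : QuadricBetti.pureCone ≤ QuadricBetti.bettiCone (QuadricBetti.quadricGrading q) := by
    refine Submodule.span_le.2 ?_
    rintro _ ⟨d, rfl⟩
    exact Submodule.subset_span (Λ.isBettiDiagram_pureDiagram d)
  have h2 := QuadricBetti.bettiCone_le_facetPointedCone Λ
  have h3 := QuadricBetti.facetCone_subset_pureCone
  exact ⟨Set.Subset.antisymm (fun v hv => h3 (h2 hv)) h1,
    Set.Subset.antisymm (fun v hv => h2 (h1 hv)) h3⟩
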